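/- Let $d\ge 2$ and $\epsilon>0$, and put $$s_0=\begin{cases}\frac13, & d=2,\\ \frac d2-\frac d{d+1}+\epsilon, & d\ge 3 \text{ odd},\\ \frac d2-1+\epsilon, & d\ge 4\text{ even}.\end{cases}$$ For $\alpha=(\alpha_1,\dots,\alpha_d)$ with $\frac12\le\alpha_j\le 2$ let $\mathbb T^d=\mathbb R^d/\prod_{j=1}^d\alpha_j\mathbb Z$, and for $f\in L^2(\mathbb T^d)$ let $\hat f(n)$, $n\in\mathbb Z^d$, be its Fourier coefficients with respect to the characters $e_n(x)=\exp\big(2\pi i\sum_j n_jx_j/\alpha_j\big)$. The spectrum of $f$ is $\{n\in\mathbb Z^d:\hat f(n)\neq 0\}$, and $$e^{it\Delta}f=\sum_{n\in\mathbb Z^d}e^{-itQ(n)}\hat f(n)e_n,\qquad Q(n)=\sum_{j=1}^d\Big(\frac{2\pi n_j}{\alpha_j}\Big)^2 .$$ Then for every $T>0$ there is a constant $C$, depending only on $d$, $\epsilon$ and $T$, such that for all such $\alpha$, all real $N_1,N_2\ge 1$ and all $f_1,f_2\in L^2(\mathbb T^d)$ whose spectra lie in $[-N_1,N_1]^d$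 and $[-N_2,N_2]^d$ respectively, $$\big\|e^{it\Delta}f_1\; e^{it\Delta}f_2\big\|_{L^2_tL^2_x([-T,T]\times\mathbb T^d)}\le C\,\min(N_1,N_2)^{s_0}\,\|f_1\|_{L^2(\mathbb T^d)}\|f_2\|_{L^2(\mathbb T^d)} .$$ -/

import Mathlib

open MeasureTheory

noncomputable section

namespace FlatTorus

/-- The flat torus `ℝ^d / ∏ⱼ αⱼ ℤ`, as the product of the circles `ℝ / αⱼ ℤ`.
Its `volume` is Lebesgue measure, of total mass `∏ⱼ αⱼ`. -/
abbrev Torus {d : ℕ} (α : Fin d → ℝ) : Type := (j : Fin d) → AddCircle (α j)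

/-- The character `x ↦ exp (2 π i ∑ⱼ nⱼ xⱼ / αⱼ)` of the torus. -/
def mode {d : ℕ} (α : Fin d → ℝ) (n : Fin d → ℤ) : C(Torus α, ℂ) where
  toFun x := ∏ j, fourier (n j) (x j)
  continuous_toFun := by fun_prop

/-- The space `L²(𝕋^d)` of complex-valued functions on the torus. -/
abbrev L2 {d : ℕ} (α : Fin d → ℝ) [∀ j, Fact (0 < α j)] : Type :=
  Lp ℂ 2 (volume : Measure (Torus α))

/-- The character `mode α n` as an element of `L²(𝕋^d)`. -/
def modeLp {d : ℕ} (α : Fin d → ℝ) [∀ j, Fact (0 < α j)] (n : Fin d → ℤ) : L2 α :=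
  ContinuousMap.toLp 2 volume ℂ (mode α n)

/-- The `n`-th Fourier coefficient of `f`. -/
def coeff {d : ℕ} {α : Fin d → ℝ} [∀ j, Fact (0 < α j)] (f : L2 α) (n : Fin d → ℤ) : ℂ :=
  ((∏ j, α j : ℝ) : ℂ)⁻¹ * ∫ x, f x * mode α (-n) x

/-- The spectrum of `f`: the set of indices of its nonzero Fourier coefficients. -/
def spectrum {d : ℕ} {α : Fin d → ℝ} [∀ j, Fact (0 < α j)] (f : L2 α) : Set (Fin d → ℤ) :=
  {n | coeff f n ≠ 0}

/-- The integer points of the cube `[-N, N]^d`. -/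
def box (d : ℕ) (N : ℝ) : Set (Fin d → ℤ) :=
  {n | ∀ j, (n j : ℝ) ∈ Set.Icc (-N) N}

/-- The eigenvalue of `-Δ` on `mode α n`, namely `∑ⱼ (2 π nⱼ / αⱼ)²`. -/
def Q {d : ℕ} (α : Fin d → ℝ) (n : Fin d → ℤ) : ℝ :=
  ∑ j, (2 * Real.pi * n j / α j) ^ 2

/-- The Schrödinger group `e^{itΔ}` on `L²(𝕋^d)`, as the Fourier multiplier `e^{-it Q(n)}`;
the series converges in `L²(𝕋^d)` (see `summable_schrodinger`). -/
def schrodinger {d : ℕ} {α : Fin d → ℝ} [∀ j, Fact (0 < α j)] (t : ℝ) (f : L2 α) : L2 α :=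
  ∑' n : Fin d → ℤ, (Complex.exp (-Complex.I * t * Q α n) * coeff f n) • modeLp α n

/-- The norm of `w` in `L²_t L²_x ([-T, T] × 𝕋^d)`, with values in `[0, ∞]`. -/
def normL2L2 {d : ℕ} {α : Fin d → ℝ} [∀ j, Fact (0 < α j)] (T : ℝ)
    (w : ℝ → Torus α → ℂ) : ENNReal :=
  eLpNorm (fun t : ℝ => eLpNorm (w t) 2 (volume : Measure (Torus α))) 2
    ((volume : Measure ℝ).restrict (Set.Icc (-T) T))

/-- The Strichartz exponent in dimension `d ≥ 2` (there is no loss `ε` when `d = 2`). -/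
def s₀ (d : ℕ) (ε : ℝ) : ℝ :=
  if d = 2 then 1 / 3
  else if Odd d then (d : ℝ) / 2 - d / (d + 1) + ε
  else (d : ℝ) / 2 - 1 + ε

lemma prod_pos {d : ℕ} (α : Fin d → ℝ) [h : ∀ j, Fact (0 < α j)] : 0 < ∏ j, α j :=
  Finset.prod_pos fun j _ => (h j).out

lemma mode_neg {d : ℕ} (α : Fin d → ℝ) (n : Fin d → ℤ) (x : Torus α) :
    mode α (-n) x = (starRingEnd ℂ) (mode α n x) := by
  simp [mode, map_prod]

lemma integral_fourier {a : ℝ} [h : Fact (0 < a)] (k : ℤ) :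
    ∫ x : AddCircle a, fourier k x = if k = 0 then (a : ℂ) else 0 := by
  split_ifs with hk
  · subst hk
    simp [h.out.le, Measure.real, AddCircle.measure_univ]
  · have := integral_eq_zero_of_add_right_eq_neg (μ := (volume : Measure (AddCircle a)))
      (fourier_add_half_inv_index hk h.out)
    exact this

lemma integral_mode {d : ℕ} (α : Fin d → ℝ) [∀ j, Fact (0 < α j)] (n : Fin d → ℤ) :
    ∫ x, mode α n x = if n = 0 then ((∏ j, α j : ℝ) : ℂ) else 0 := by
  have h := integral_fintype_prod_eq_prod (𝕜 := ℂ) (E := fun j => AddCircle (α j))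
    (μ := fun j => (volume : Measure (AddCircle (α j))))
    (fun j (y : AddCircle (α j)) => (fourier (n j) y : ℂ))
  have h2 : ∫ x, mode α n x = ∏ j, ∫ y : AddCircle (α j), (fourier (n j) y : ℂ) := h
  rw [h2]
  simp only [integral_fourier]
  split_ifs with hn
  · subst hn; simp
  · obtain ⟨j, hj⟩ := Function.ne_iff.mp hn
    exact Finset.prod_eq_zero (Finset.mem_univ j) (if_neg hj)

lemma inner_modeLp_left {d : ℕ} {α : Fin d → ℝ} [∀ j, Fact (0 < α j)] (f : L2 α)
    (n : Fin d → ℤ) :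
    inner ℂ (modeLp α n) f = ((∏ j, α j : ℝ) : ℂ) * coeff f n := by
  have h0 : ((∏ j, α j : ℝ) : ℂ) ≠ 0 := by exact_mod_cast (prod_pos α).ne'
  rw [coeff, mul_inv_cancel_left₀ h0, L2.inner_def]
  refine integral_congr_ae ?_
  filter_upwards [ContinuousMap.coeFn_toLp (p := 2) (𝕜 := ℂ) volume (mode α n)] with x hx
  rw [mode_neg, modeLp, hx]
  simp [RCLike.inner_apply]

lemma coeff_modeLp {d : ℕ} {α : Fin d → ℝ} [∀ j, Fact (0 < α j)] (m n : Fin d → ℤ) :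
    coeff (modeLp α m) n = if m = n then 1 else 0 := by
  have h0 : ((∏ j, α j : ℝ) : ℂ) ≠ 0 := by exact_mod_cast (prod_pos α).ne'
  have h1 : ∫ x, (modeLp α m) x * mode α (-n) x = ∫ x, mode α (m - n) x := by
    refine integral_congr_ae ?_
    filter_upwards [ContinuousMap.coeFn_toLp (p := 2) (𝕜 := ℂ) volume (mode α m)] with x hx
    rw [modeLp, hx]
    simp only [mode, ContinuousMap.coe_mk, ← Finset.prod_mul_distrib, sub_eq_add_neg, Pi.add_apply,
      fourier_add]
  rw [coeff, h1, integral_mode]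
  simp only [sub_eq_zero]
  split_ifs
  · exact inv_mul_cancel₀ h0
  · simp

/-- The series defining `schrodinger t f` converges in `L²(𝕋^d)`. -/
lemma summable_schrodinger {d : ℕ} {α : Fin d → ℝ} [∀ j, Fact (0 < α j)] (t : ℝ) (f : L2 α) :
    Summable fun n : Fin d → ℤ =>
      (Complex.exp (-Complex.I * t * Q α n) * coeff f n) • modeLp α n := by
  set V : ℝ := ∏ j, α j with hV
  have hVpos : 0 < V := prod_pos α
  set r : ℝ := (Real.sqrt V)⁻¹ with hr
  have hrpos : 0 < r := inv_pos.mpr (Real.sqrt_pos.mpr hVpos)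
  have hrr : r * r * V = 1 := by
    rw [hr, ← mul_inv, Real.mul_self_sqrt hVpos.le, inv_mul_cancel₀ hVpos.ne']
  have hrr' : (r : ℂ) * (r * V) = 1 := by rw [← mul_assoc]; exact_mod_cast hrr
  have hon : Orthonormal ℂ fun n : Fin d → ℤ => (r : ℂ) • modeLp α n := by
    rw [orthonormal_iff_ite]
    intro m n
    rw [inner_smul_left, inner_smul_right, inner_modeLp_left, coeff_modeLp, Complex.conj_ofReal]
    by_cases h : m = n
    · simp only [h, if_true, mul_one, ← hV, hrr']
    · simp [h, Ne.symm h]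
  have hb := hon.inner_products_summable f
  have hs := (hon.orthogonalFamily.summable_iff_norm_sq_summable
    (fun n => Complex.exp (-Complex.I * t * Q α n) * inner ℂ ((r : ℂ) • modeLp α n) f)).2 (by
      refine hb.congr fun n => ?_
      rw [norm_mul, show (-Complex.I * t * Q α n : ℂ) = ((-(t * Q α n) : ℝ) : ℂ) * Complex.I by
        push_cast; ring, Complex.norm_exp_ofReal_mul_I, one_mul])
  refine hs.congr fun n => ?_
  rw [LinearIsometry.toSpanSingleton_apply, inner_smul_left, inner_modeLp_left, ← hV,
    Complex.conj_ofReal, smul_smul]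
  congr 1
  linear_combination (Complex.exp (-Complex.I * t * Q α n) * coeff f n) * hrr'

end FlatTorus

end

/-! ### A local large sieve inequality in time. -/

section LargeSieve

/-! The `p`-th Fourier coefficient of the product is an exponential sum in `t` over the pairs `n₁ +
n₂ = p`, with frequencies `Q n₁ + Q n₂`. A local large sieve (`integral_norm_sq_le_of_card`) bounds
its mean square on `[-T, T]` by the `ℓ²` norm of its coefficients times the largest number of pairs
with energy in a unit interval, so only a count is left (`normL2L2_le_of_card`).

By the parallelogram law the difference `m = n₁ - n₂` satisfies `Q m = 2 (Q n₁ + Q n₂) - Q p`, and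
`m = 2 n₁ - p` lies in a cube of side `O(N)` about `-p`. Placing just one of the two frequencies in
a box suffices, which is why the smaller of `N₁`, `N₂` governs. It remains to count lattice points
of a cube of side `2 L` in a shell of width 2 of a diagonal form, uniformly in the cube, the shell
and the form (`ShellBound`). The exponent needed is `2 s₀`.

For `d ≥ 3` the form is split into two groups of variables, and AM-GM bounds the count by the
additive energies of the groups (`two_mul_card_le_collisions`). A second splitting isolates each
coefficient `θ ≥ 1` in front of an integer; taking the floor of `θ` times an integer is injective,
so the arithmetic of `θ` disappears and the equation `m² - n² = k² - l²` remains. The divisor bound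
gives `L ^ (2 + δ)` for the latter. The outcome is `3/2 + δ` for `d = 3`, `2 + δ` for `d = 4`, and
one more power of `L` for each further variable; for odd `d ≥ 5` this is better than required.

For `d = 2` there is no `δ`. Three lattice points of the shell are not collinear, so they span a
triangle of area at least `1/2`; a short arc of a large ellipse has no room for it. Hence arcs of
length about `R ^ (1/3)`, with `R` the radius, hold at most two points, and `min (L / R ^ (1/3)) (R
^ (2/3))` is `O(L ^ (2/3))` (`shellBound_two`). -/

lemma integrable_exp_neg_sq_mul_char (x : ℝ) :
    Integrable fun t : ℝ => Complex.exp (-(1 : ℂ) * (t : ℂ) ^ 2) * Complex.exp (-Complex.I * t * x) := by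
  have h := GaussianFourier.integrable_cexp_neg_mul_sq_add_real_mul_I (b := 1) (by simp) 0
  have h' : Integrable fun t : ℝ => Complex.exp (-(1 : ℂ) * (t : ℂ) ^ 2) := by simpa using h
  refine h'.mul_bdd (c := 1) (by fun_prop) (Filter.Eventually.of_forall fun t => ?_)
  rw [show (-Complex.I * t * x : ℂ) = ((-(t * x) : ℝ) : ℂ) * Complex.I by push_cast; ring,
    Complex.norm_exp_ofReal_mul_I]

lemma integral_exp_neg_sq_mul_char (x : ℝ) :
    ∫ t : ℝ, Complex.exp (-(1 : ℂ) * (t : ℂ) ^ 2) * Complex.exp (-Complex.I * t * x) =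
      ((√Real.pi * Real.exp (-x ^ 2 / 4) : ℝ) : ℂ) := by
  have h := fourierIntegral_gaussian (b := 1) (by simp) (-x : ℂ)
  have e : ∀ t : ℝ, Complex.exp (-(1 : ℂ) * (t : ℂ) ^ 2) * Complex.exp (-Complex.I * t * x) =
      Complex.exp (Complex.I * (-x) * t) * Complex.exp (-1 * (t : ℂ) ^ 2) := fun t => by
    rw [mul_comm]; congr 2; ring
  simp_rw [e]
  rw [h, Real.sqrt_eq_rpow, Complex.ofReal_mul, Complex.ofReal_cpow Real.pi_pos.le,
    Complex.ofReal_exp]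
  push_cast
  norm_num

/-- The Gaussian weight makes the off-diagonal terms explicit: expanding the square leaves its
Fourier transform, a positive Gaussian, at the differences of frequencies. -/
lemma integral_gaussian_norm_sq_le {ι : Type*} (S : Finset ι) (freq : ι → ℝ) (c : ι → ℂ) :
    ∫ t : ℝ, Real.exp (-t ^ 2) * ‖∑ i ∈ S, c i * Complex.exp (-Complex.I * t * freq i)‖ ^ 2 ≤
      √Real.pi * ∑ i ∈ S, ∑ j ∈ S, ‖c i‖ * ‖c j‖ * Real.exp (-(freq i - freq j) ^ 2 / 4) := by
  have key : ((∫ t : ℝ, Real.exp (-t ^ 2) *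
      ‖∑ i ∈ S, c i * Complex.exp (-Complex.I * t * freq i)‖ ^ 2 : ℝ) : ℂ) =
      ∑ i ∈ S, ∑ j ∈ S, (c i * (starRingEnd ℂ) (c j)) *
        ((√Real.pi * Real.exp (-(freq i - freq j) ^ 2 / 4) : ℝ) : ℂ) := by
    rw [← integral_complex_ofReal]
    have e : ∀ t : ℝ, ((Real.exp (-t ^ 2) *
        ‖∑ i ∈ S, c i * Complex.exp (-Complex.I * t * freq i)‖ ^ 2 : ℝ) : ℂ) =
        ∑ i ∈ S, ∑ j ∈ S, (c i * (starRingEnd ℂ) (c j)) *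
          (Complex.exp (-(1 : ℂ) * (t : ℂ) ^ 2) *
            Complex.exp (-Complex.I * t * (freq i - freq j : ℝ))) := by
      intro t
      push_cast
      rw [← Complex.mul_conj', map_sum, Finset.sum_mul_sum, Finset.mul_sum]
      refine Finset.sum_congr rfl fun i _ => ?_
      rw [Finset.mul_sum]
      refine Finset.sum_congr rfl fun j _ => ?_
      have h1 : Complex.exp (-Complex.I * t * (freq i - freq j)) =
          Complex.exp (-Complex.I * t * freq i) * Complex.exp (Complex.I * t * freq j) := by
        rw [← Complex.exp_add]; ring_nf
      have h2 : (starRingEnd ℂ) (Complex.exp (-Complex.I * t * freq j)) =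
          Complex.exp (Complex.I * t * freq j) := by
        rw [← Complex.exp_conj]
        simp only [map_mul, map_neg, Complex.conj_I, Complex.conj_ofReal, neg_neg]
      rw [map_mul, h1, h2, neg_one_mul]
      generalize Complex.exp (-Complex.I * t * freq i) = u
      generalize Complex.exp (Complex.I * t * freq j) = v
      generalize Complex.exp (-(t : ℂ) ^ 2) = w
      ring
    simp_rw [e]
    rw [integral_finsetSum _ fun i _ => integrable_finsetSum _ fun j _ =>
      (integrable_exp_neg_sq_mul_char _).const_mul _]
    refine Finset.sum_congr rfl fun i _ => ?_
    rw [integral_finsetSum _ fun j _ => (integrable_exp_neg_sq_mul_char _).const_mul _]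
    refine Finset.sum_congr rfl fun j _ => ?_
    rw [integral_const_mul, integral_exp_neg_sq_mul_char]
  refine (le_abs_self _).trans ?_
  rw [← Real.norm_eq_abs, ← Complex.norm_real, key, Finset.mul_sum]
  refine (norm_sum_le _ _).trans (Finset.sum_le_sum fun i _ => ?_)
  rw [Finset.mul_sum]
  refine (norm_sum_le _ _).trans (Finset.sum_le_sum fun j _ => ?_)
  rw [norm_mul, norm_mul, RCLike.norm_conj, Complex.norm_real, Real.norm_of_nonneg (by positivity)]
  exact le_of_eq (by ring)

lemma summable_inv_one_add_int_sq : Summable fun k : ℤ => 12 / (1 + (k : ℝ) ^ 2) := by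
  have h : Summable fun k : ℤ => 12 * (1 / (k : ℝ) ^ 2) :=
    (Real.summable_one_div_int_pow.2 one_lt_two).mul_left 12
  refine h.of_norm_bounded_eventually ?_
  have : ∀ᶠ k : ℤ in Filter.cofinite, k ≠ 0 := by
    exact (Set.finite_singleton (0 : ℤ)).eventually_cofinite_notMem
  filter_upwards [this] with k hk
  have hk' : 0 < (k : ℝ) ^ 2 := by positivity
  rw [Real.norm_of_nonneg (by positivity), mul_one_div]
  gcongr
  linarith

lemma exp_neg_sq_div_four_le (x : ℝ) :
    Real.exp (-x ^ 2 / 4) ≤ 12 / (1 + (⌊x⌋ : ℝ) ^ 2) := by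
  rw [le_div_iff₀ (by positivity), ← le_div_iff₀' (Real.exp_pos _), neg_div, Real.exp_neg, div_inv_eq_mul]
  have h1 := Real.add_one_le_exp (x ^ 2 / 4)
  have h2 := Int.floor_le x
  have h3 := Int.lt_floor_add_one x
  -- `12 * (1 + x² / 4) = 12 + 3 x²` dominates `1 + ⌊x⌋²`, as the floor is within 1 of `x`.
  nlinarith [sq_nonneg ((⌊x⌋ : ℝ) - 2 * x), sq_nonneg ((⌊x⌋ : ℝ) - x)]

lemma sum_exp_neg_sq_le {ι : Type*} (S : Finset ι) (freq : ι → ℝ) (M : ℝ)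
    (hM : ∀ a : ℝ, ((S.filter fun i => freq i ∈ Set.Icc a (a + 1)).card : ℝ) ≤ M) (y : ℝ) :
    ∑ j ∈ S, Real.exp (-(y - freq j) ^ 2 / 4) ≤ M * ∑' k : ℤ, 12 / (1 + (k : ℝ) ^ 2) := by
  classical
  calc ∑ j ∈ S, Real.exp (-(y - freq j) ^ 2 / 4)
      ≤ ∑ j ∈ S, 12 / (1 + (⌊freq j - y⌋ : ℝ) ^ 2) := by
        refine Finset.sum_le_sum fun j _ => ?_
        rw [← neg_sub, neg_sq]
        exact exp_neg_sq_div_four_le _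
    _ = ∑ k ∈ S.image (fun j => ⌊freq j - y⌋),
          ((S.filter fun j => ⌊freq j - y⌋ = k).card : ℝ) * (12 / (1 + (k : ℝ) ^ 2)) := by
        rw [Finset.sum_comp (fun k : ℤ => 12 / (1 + (k : ℝ) ^ 2)) (fun j => ⌊freq j - y⌋)]
        simp
    _ ≤ ∑ k ∈ S.image (fun j => ⌊freq j - y⌋), M * (12 / (1 + (k : ℝ) ^ 2)) := by
        refine Finset.sum_le_sum fun k _ => mul_le_mul_of_nonneg_right ?_ (by positivity)
        refine le_trans ?_ (hM (y + k))
        norm_cast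
        refine Finset.card_le_card fun j hj => ?_
        simp only [Finset.mem_filter, Set.mem_Icc, Int.floor_eq_iff] at hj ⊢
        exact ⟨hj.1, by linarith [hj.2.1], by linarith [hj.2.2]⟩
    _ ≤ _ := by
        have hM0 : 0 ≤ M := (Nat.cast_nonneg _).trans (hM 0)
        rw [← Finset.mul_sum]
        exact mul_le_mul_of_nonneg_left
          (summable_inv_one_add_int_sq.sum_le_tsum _ fun k _ => by positivity) hM0

/-- The constant of `integral_norm_sq_le_of_card`. -/
noncomputable def sieveConst (T : ℝ) : ℝ :=
  Real.exp (T ^ 2) * (√Real.pi * ∑' k : ℤ, 12 / (1 + (k : ℝ) ^ 2))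

lemma sieveConst_nonneg (T : ℝ) : 0 ≤ sieveConst T := by
  unfold sieveConst
  have : 0 ≤ ∑' k : ℤ, 12 / (1 + (k : ℝ) ^ 2) := tsum_nonneg fun k => by positivity
  positivity

/-- A local large sieve inequality: exponential sums whose frequencies lie at most `M` to a unit
interval are almost orthogonal on `[-T, T]` up to a factor of order `M`. -/
lemma integral_norm_sq_le_of_card {ι : Type*} (S : Finset ι) (freq : ι → ℝ) (c : ι → ℂ) (T M : ℝ)
    (hM : ∀ a : ℝ, ((S.filter fun i => freq i ∈ Set.Icc a (a + 1)).card : ℝ) ≤ M) :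
    ∫ t in Set.Icc (-T) T, ‖∑ i ∈ S, c i * Complex.exp (-Complex.I * t * freq i)‖ ^ 2 ≤
      sieveConst T * M * ∑ i ∈ S, ‖c i‖ ^ 2 := by
  set F : ℝ → ℝ := fun t => ‖∑ i ∈ S, c i * Complex.exp (-Complex.I * t * freq i)‖ ^ 2 with hF
  have hFc : Continuous F := by fun_prop
  have hFb : ∀ t, F t ≤ (∑ i ∈ S, ‖c i‖) ^ 2 := by
    intro t
    refine pow_le_pow_left₀ (norm_nonneg _) ((norm_sum_le _ _).trans (le_of_eq ?_)) 2
    refine Finset.sum_congr rfl fun i _ => ?_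
    rw [norm_mul, show (-Complex.I * t * freq i : ℂ) = ((-(t * freq i) : ℝ) : ℂ) * Complex.I by
      push_cast; ring, Complex.norm_exp_ofReal_mul_I, mul_one]
  have hint : Integrable fun t : ℝ => Real.exp (-t ^ 2) * F t := by
    have hg : Integrable fun t : ℝ => Real.exp (-t ^ 2) := by
      simpa using integrable_exp_neg_mul_sq one_pos
    refine hg.mul_bdd (c := (∑ i ∈ S, ‖c i‖) ^ 2) (by fun_prop)
      (Filter.Eventually.of_forall fun t => ?_)
    rw [Real.norm_of_nonneg (by positivity)]
    exact hFb t
  set Z : ℝ := ∑' k : ℤ, 12 / (1 + (k : ℝ) ^ 2) with hZ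
  -- On `[-T, T]` the weight `exp (-t²)` is at least `exp (-T²)`.
  have h1 : ∫ t in Set.Icc (-T) T, F t ≤
      ∫ t in Set.Icc (-T) T, Real.exp (T ^ 2) * (Real.exp (-t ^ 2) * F t) := by
    refine setIntegral_mono_on hFc.integrableOn_Icc (hint.const_mul _).integrableOn
      measurableSet_Icc fun t ht => ?_
    rw [← mul_assoc, ← Real.exp_add]
    refine le_mul_of_one_le_left (by positivity) (Real.one_le_exp ?_)
    nlinarith [ht.1, ht.2]
  have h2 : ∫ t in Set.Icc (-T) T, Real.exp (T ^ 2) * (Real.exp (-t ^ 2) * F t) ≤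
      Real.exp (T ^ 2) * ∫ t, Real.exp (-t ^ 2) * F t := by
    rw [integral_const_mul]
    refine mul_le_mul_of_nonneg_left ?_ (Real.exp_pos _).le
    exact setIntegral_le_integral hint (Filter.Eventually.of_forall fun t => by positivity)
  have h3 := integral_gaussian_norm_sq_le S freq c
  -- Schur test: AM-GM separates `c i` from `c j`, and every row and column sum of the kernel is at
  -- most `M * Z`.
  have h4 : ∑ i ∈ S, ∑ j ∈ S, ‖c i‖ * ‖c j‖ * Real.exp (-(freq i - freq j) ^ 2 / 4) ≤
      ∑ i ∈ S, ‖c i‖ ^ 2 * (M * Z) := by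
    have h5 : ∑ i ∈ S, ∑ j ∈ S, ‖c i‖ * ‖c j‖ * Real.exp (-(freq i - freq j) ^ 2 / 4) ≤
        ∑ i ∈ S, ∑ j ∈ S, (‖c i‖ ^ 2 / 2 * Real.exp (-(freq i - freq j) ^ 2 / 4) +
          ‖c j‖ ^ 2 / 2 * Real.exp (-(freq i - freq j) ^ 2 / 4)) := by
      refine Finset.sum_le_sum fun i _ => Finset.sum_le_sum fun j _ => ?_
      rw [← add_mul]
      refine mul_le_mul_of_nonneg_right ?_ (Real.exp_pos _).le
      nlinarith [sq_nonneg (‖c i‖ - ‖c j‖)]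
    refine h5.trans ?_
    simp_rw [Finset.sum_add_distrib]
    rw [Finset.sum_comm (f := fun i j => ‖c j‖ ^ 2 / 2 * Real.exp (-(freq i - freq j) ^ 2 / 4)),
      ← Finset.sum_add_distrib]
    refine Finset.sum_le_sum fun i _ => ?_
    rw [← Finset.mul_sum, ← Finset.mul_sum]
    have h6 := sum_exp_neg_sq_le S freq M hM (freq i)
    have h7 : ∑ j ∈ S, Real.exp (-(freq j - freq i) ^ 2 / 4) ≤ M * Z := by
      refine le_trans (le_of_eq (Finset.sum_congr rfl fun j _ => ?_)) h6
      rw [← neg_sub, neg_sq]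
    have h8 : 0 ≤ ‖c i‖ ^ 2 / 2 := by positivity
    nlinarith [mul_le_mul_of_nonneg_left h6 h8, mul_le_mul_of_nonneg_left h7 h8]
  calc _ ≤ Real.exp (T ^ 2) * (√Real.pi * ∑ i ∈ S, ‖c i‖ ^ 2 * (M * Z)) := by
        refine h1.trans (h2.trans (mul_le_mul_of_nonneg_left (h3.trans ?_) (Real.exp_pos _).le))
        exact mul_le_mul_of_nonneg_left h4 (Real.sqrt_nonneg _)
    _ = _ := by
        rw [← Finset.sum_mul, sieveConst]
        ring

end LargeSieve

/-! ### Reduction of the bilinear estimate to counting pairs of frequencies. -/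

namespace FlatTorus

lemma mode_mul {d : ℕ} {α : Fin d → ℝ} (m n : Fin d → ℤ) (x : Torus α) :
    mode α m x * mode α n x = mode α (m + n) x := by
  simp only [mode, ContinuousMap.coe_mk, ← Finset.prod_mul_distrib, Pi.add_apply, fourier_add]

variable {d : ℕ} {α : Fin d → ℝ} [∀ j, Fact (0 < α j)]

lemma norm_sq_sum_smul_modeLp (P : Finset (Fin d → ℤ)) (c : (Fin d → ℤ) → ℂ) :
    ‖∑ p ∈ P, c p • modeLp α p‖ ^ 2 = (∏ j, α j) * ∑ p ∈ P, ‖c p‖ ^ 2 := by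
  have h : ((‖∑ p ∈ P, c p • modeLp α p‖ ^ 2 : ℝ) : ℂ) =
      (((∏ j, α j) * ∑ p ∈ P, ‖c p‖ ^ 2 : ℝ) : ℂ) := by
    have := inner_self_eq_norm_sq_to_K (𝕜 := ℂ) (∑ p ∈ P, c p • modeLp α p)
    rw [Complex.ofReal_pow]
    refine Eq.trans this.symm ?_
    rw [sum_inner, Complex.ofReal_mul, Complex.ofReal_sum, Finset.mul_sum]
    refine Finset.sum_congr rfl fun p hp => ?_
    rw [inner_sum, Finset.sum_eq_single p]
    · rw [inner_smul_left, inner_smul_right, inner_modeLp_left, coeff_modeLp, if_pos rfl,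
        Complex.ofReal_pow, ← Complex.conj_mul']
      ring
    · intro q _ hq
      rw [inner_smul_left, inner_smul_right, inner_modeLp_left, coeff_modeLp, if_neg hq]
      simp
    · exact fun h => absurd hp h
  exact_mod_cast h

/-- Bessel's inequality for the characters of the torus. -/
lemma prod_mul_sum_coeff_sq_le (f : L2 α) (B : Finset (Fin d → ℤ)) :
    (∏ j, α j) * ∑ n ∈ B, ‖coeff f n‖ ^ 2 ≤ ‖f‖ ^ 2 := by
  set g := ∑ p ∈ B, coeff f p • modeLp α p with hg
  have h1 : inner ℂ g f = (((∏ j, α j) * ∑ n ∈ B, ‖coeff f n‖ ^ 2 : ℝ) : ℂ) := by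
    rw [hg, sum_inner, Complex.ofReal_mul, Complex.ofReal_sum, Finset.mul_sum]
    refine Finset.sum_congr rfl fun p hp => ?_
    rw [inner_smul_left, inner_modeLp_left, Complex.ofReal_pow, ← Complex.conj_mul']
    ring
  have h2 : ‖g‖ ^ 2 = (∏ j, α j) * ∑ n ∈ B, ‖coeff f n‖ ^ 2 := norm_sq_sum_smul_modeLp B _
  have h3 : ‖inner ℂ g f‖ ≤ ‖g‖ * ‖f‖ := norm_inner_le_norm g f
  rw [h1, ← h2, Complex.norm_real, Real.norm_of_nonneg (by positivity)] at h3
  rw [← h2]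
  refine pow_le_pow_left₀ (norm_nonneg _) ?_ 2
  rcases (norm_nonneg g).eq_or_lt with h | h
  · rw [← h]; exact norm_nonneg f
  · exact le_of_mul_le_mul_left (by rwa [sq] at h3) h

lemma coeFn_sum_smul_modeLp (P : Finset (Fin d → ℤ)) (c : (Fin d → ℤ) → ℂ) :
    (∑ p ∈ P, c p • modeLp α p : L2 α) =ᵐ[volume] fun x => ∑ p ∈ P, c p * mode α p x := by
  have h : (∑ p ∈ P, c p • modeLp α p : L2 α) =
      ContinuousMap.toLp 2 volume ℂ (∑ p ∈ P, c p • mode α p) := by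
    simp [modeLp, map_sum]
  rw [h]
  filter_upwards [ContinuousMap.coeFn_toLp (p := 2) (𝕜 := ℂ) volume (∑ p ∈ P, c p • mode α p)]
    with x hx
  rw [hx]
  simp

lemma finite_box (N : ℝ) : (box d N).Finite := by
  have : box d N ⊆ ((Fintype.piFinset fun _ : Fin d => Finset.Icc (-⌊N⌋) ⌊N⌋ : Finset _) :
      Set (Fin d → ℤ)) := by
    intro n hn
    simp only [Finset.mem_coe, Fintype.mem_piFinset, Finset.mem_Icc]
    intro j
    have := hn j
    refine ⟨?_, Int.le_floor.2 this.2⟩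
    have h : -n j ≤ ⌊N⌋ := Int.le_floor.2 (by push_cast; linarith [this.1])
    linarith
  exact (Finset.finite_toSet _).subset this

lemma schrodinger_eq_sum {f : L2 α} {B : Finset (Fin d → ℤ)} (hB : spectrum f ⊆ B) (t : ℝ) :
    schrodinger t f =
      ∑ n ∈ B, (Complex.exp (-Complex.I * t * Q α n) * coeff f n) • modeLp α n := by
  refine tsum_eq_sum fun n hn => ?_
  have : coeff f n = 0 := by
    by_contra h
    exact hn (hB h)
  simp [this]

/-- A bound for the number of pairs of frequencies with prescribed sum and almost prescribed
total energy gives a bilinear estimate. -/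
theorem normL2L2_le_of_card {T M : ℝ} {D₁ D₂ : Set (Fin d → ℤ)} (hD₁ : D₁.Finite)
    (hD₂ : D₂.Finite)
    (hcard : ∀ (p : Fin d → ℤ) (a : ℝ) (S : Finset ((Fin d → ℤ) × (Fin d → ℤ))),
      (∀ x ∈ S, x.1 ∈ D₁ ∧ x.2 ∈ D₂ ∧ x.1 + x.2 = p ∧
        Q α x.1 + Q α x.2 ∈ Set.Icc a (a + 1)) → (S.card : ℝ) ≤ M)
    (f₁ f₂ : L2 α) (h₁ : spectrum f₁ ⊆ D₁) (h₂ : spectrum f₂ ⊆ D₂) :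
    normL2L2 T (fun t x => schrodinger t f₁ x * schrodinger t f₂ x) ≤
      ENNReal.ofReal (√(sieveConst T * M / ∏ j, α j) * ‖f₁‖ * ‖f₂‖) := by
  classical
  have hM : 0 ≤ M := by simpa using hcard 0 0 ∅ (by simp)
  set V : ℝ := ∏ j, α j with hV
  have hVpos : 0 < V := prod_pos α
  set B₁ := hD₁.toFinset with hB₁
  set B₂ := hD₂.toFinset with hB₂
  set P := (B₁ ×ˢ B₂).image (fun x => x.1 + x.2) with hP
  set F : (Fin d → ℤ) → Finset ((Fin d → ℤ) × (Fin d → ℤ)) :=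
    fun p => (B₁ ×ˢ B₂).filter fun x => x.1 + x.2 = p with hF
  -- The `p`-th Fourier coefficient of the product at time `t`.
  set C : (Fin d → ℤ) → ℝ → ℂ := fun p t =>
    ∑ x ∈ F p, (coeff f₁ x.1 * coeff f₂ x.2) *
      Complex.exp (-Complex.I * t * (Q α x.1 + Q α x.2 : ℝ)) with hC
  have hmaps : ∀ x ∈ B₁ ×ˢ B₂, x.1 + x.2 ∈ P := fun x hx => Finset.mem_image_of_mem _ hx
  have hprod : ∀ t : ℝ, (fun x => schrodinger t f₁ x * schrodinger t f₂ x) =ᵐ[volume]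
      (∑ p ∈ P, C p t • modeLp α p : L2 α) := by
    intro t
    rw [schrodinger_eq_sum (B := B₁) (by simpa [hB₁] using h₁),
      schrodinger_eq_sum (B := B₂) (by simpa [hB₂] using h₂)]
    filter_upwards [coeFn_sum_smul_modeLp B₁ fun n =>
        Complex.exp (-Complex.I * t * Q α n) * coeff f₁ n,
      coeFn_sum_smul_modeLp B₂ fun n => Complex.exp (-Complex.I * t * Q α n) * coeff f₂ n,
      coeFn_sum_smul_modeLp P fun p => C p t] with x hx₁ hx₂ hx
    rw [hx₁, hx₂, hx, Finset.sum_mul_sum, ← Finset.sum_product',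
      ← Finset.sum_fiberwise_of_maps_to hmaps]
    refine Finset.sum_congr rfl fun p _ => ?_
    rw [hC, Finset.sum_mul]
    refine Finset.sum_congr rfl fun y hy => ?_
    rw [← (Finset.mem_filter.1 hy).2, ← mode_mul, Complex.ofReal_add, mul_add, Complex.exp_add]
    ring
  have hnorm : ∀ t : ℝ, eLpNorm (fun x => schrodinger t f₁ x * schrodinger t f₂ x) 2 volume =
      ‖(∑ p ∈ P, C p t • modeLp α p : L2 α)‖ₑ := fun t => by
    rw [Lp.enorm_def]
    exact eLpNorm_congr_ae (hprod t)
  have hCc : ∀ p, Continuous (C p) := fun p => by fun_prop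
  have hint : ∫ t in Set.Icc (-T) T, V * ∑ p ∈ P, ‖C p t‖ ^ 2 ≤
      (√(sieveConst T * M / V) * ‖f₁‖ * ‖f₂‖) ^ 2 := by
    have hCi : ∀ p, IntegrableOn (fun t => ‖C p t‖ ^ 2) (Set.Icc (-T) T) := fun p =>
      ((hCc p).norm.pow 2).integrableOn_Icc
    rw [integral_const_mul, integral_finsetSum P fun p _ => hCi p]
    have hp : ∀ p ∈ P, ∫ t in Set.Icc (-T) T, ‖C p t‖ ^ 2 ≤
        sieveConst T * M * ∑ x ∈ F p, ‖coeff f₁ x.1 * coeff f₂ x.2‖ ^ 2 := by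
      intro p _
      refine integral_norm_sq_le_of_card (F p) (fun x => Q α x.1 + Q α x.2)
        (fun x => coeff f₁ x.1 * coeff f₂ x.2) T M fun a => ?_
      refine hcard p a _ fun x hx => ?_
      simp only [hF, hB₁, hB₂, Finset.mem_filter, Finset.mem_product, Set.Finite.mem_toFinset] at hx
      exact ⟨hx.1.1.1, hx.1.1.2, hx.1.2, hx.2⟩
    -- The fibres `F p` partition `B₁ ×ˢ B₂`, so nothing is lost in summing over `p`.
    have hsum : ∑ p ∈ P, ∑ x ∈ F p, ‖coeff f₁ x.1 * coeff f₂ x.2‖ ^ 2 =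
        (∑ n ∈ B₁, ‖coeff f₁ n‖ ^ 2) * ∑ n ∈ B₂, ‖coeff f₂ n‖ ^ 2 := by
      rw [Finset.sum_mul_sum, ← Finset.sum_product', ← Finset.sum_fiberwise_of_maps_to hmaps]
      refine Finset.sum_congr rfl fun p _ => Finset.sum_congr rfl fun x _ => ?_
      rw [norm_mul, mul_pow]
    have hb₁ := prod_mul_sum_coeff_sq_le f₁ B₁
    have hb₂ := prod_mul_sum_coeff_sq_le f₂ B₂
    have hs := sieveConst_nonneg T
    calc V * ∑ p ∈ P, ∫ t in Set.Icc (-T) T, ‖C p t‖ ^ 2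
        ≤ V * ∑ p ∈ P, sieveConst T * M * ∑ x ∈ F p, ‖coeff f₁ x.1 * coeff f₂ x.2‖ ^ 2 :=
          mul_le_mul_of_nonneg_left (Finset.sum_le_sum hp) hVpos.le
      -- One factor `V` comes from the norm of the product and Bessel absorbs two, which leaves `1 /
      -- V`.
      _ = sieveConst T * M / V * ((V * ∑ n ∈ B₁, ‖coeff f₁ n‖ ^ 2) *
            (V * ∑ n ∈ B₂, ‖coeff f₂ n‖ ^ 2)) := by
          rw [← Finset.mul_sum, hsum]
          field_simp
      _ ≤ sieveConst T * M / V * (‖f₁‖ ^ 2 * ‖f₂‖ ^ 2) := by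
          refine mul_le_mul_of_nonneg_left ?_ (by positivity)
          exact mul_le_mul hb₁ hb₂ (by positivity) (by positivity)
      _ = _ := by
          rw [mul_pow, mul_pow, Real.sq_sqrt (by positivity)]
          ring
  unfold normL2L2
  simp_rw [hnorm]
  rw [eLpNorm_eq_lintegral_rpow_enorm_toReal two_ne_zero ENNReal.ofNat_ne_top]
  simp only [ENNReal.toReal_ofNat, enorm_eq_self, ENNReal.rpow_ofNat]
  have hsq : ∀ t : ℝ, ‖(∑ p ∈ P, C p t • modeLp α p : L2 α)‖ₑ ^ 2 =
      ENNReal.ofReal (V * ∑ p ∈ P, ‖C p t‖ ^ 2) := fun t => by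
    rw [← norm_sq_sum_smul_modeLp, ENNReal.ofReal_pow (norm_nonneg _), ofReal_norm]
  simp_rw [hsq]
  rw [← ofReal_integral_eq_lintegral_ofReal (Continuous.integrableOn_Icc (by fun_prop))
    (Filter.Eventually.of_forall fun t => by positivity)]
  refine (ENNReal.rpow_le_rpow (ENNReal.ofReal_le_ofReal hint) (by norm_num)).trans ?_
  rw [ENNReal.ofReal_pow (by positivity), ← ENNReal.rpow_ofNat, ← ENNReal.rpow_mul]
  norm_num

end FlatTorus

/-! ### The divisor bound. -/

section DivisorBound

lemma add_one_le_mul_two_rpow {δ : ℝ} (hδ : 0 < δ) (e : ℕ) :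
    (e + 1 : ℝ) ≤ (1 + 1 / (δ * Real.log 2)) * 2 ^ (δ * e) := by
  have hl : 0 < Real.log 2 := Real.log_pos one_lt_two
  have h1 : 1 + δ * Real.log 2 * e ≤ (2 : ℝ) ^ (δ * e) := by
    rw [Real.rpow_def_of_pos two_pos]
    linarith [Real.add_one_le_exp (Real.log 2 * (δ * e))]
  have h2 : 0 < δ * Real.log 2 := by positivity
  calc (e + 1 : ℝ) ≤ (1 + 1 / (δ * Real.log 2)) * (1 + δ * Real.log 2 * e) := by
        have : (1 + 1 / (δ * Real.log 2)) * (1 + δ * Real.log 2 * e) =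
          (e + 1) + (1 / (δ * Real.log 2) + δ * Real.log 2 * e) := by
            field_simp
            ring
        rw [this]
        have : 0 ≤ 1 / (δ * Real.log 2) + δ * Real.log 2 * e := by positivity
        linarith
    _ ≤ _ := mul_le_mul_of_nonneg_left h1 (by positivity)

/-- The divisor bound `τ(n) ≪ n^δ`. -/
theorem exists_card_divisors_le_rpow {δ : ℝ} (hδ : 0 < δ) :
    ∃ C : ℝ, 1 ≤ C ∧ ∀ n : ℕ, n ≠ 0 → (n.divisors.card : ℝ) ≤ C * (n : ℝ) ^ δ := by
  set K : ℝ := 1 + 1 / (δ * Real.log 2) with hK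
  have hl : 0 < Real.log 2 := Real.log_pos one_lt_two
  have hK1 : 1 ≤ K := by
    have : 0 ≤ 1 / (δ * Real.log 2) := by positivity
    linarith
  -- For primes `p ≥ P` one has `p ^ δ ≥ 2`, so `e + 1 ≤ 2 ^ e ≤ p ^ (δ e)` without loss. The fewer
  -- than `P + 1` smaller primes cost a factor `K` each.
  set P : ℕ := ⌈(2 : ℝ) ^ (1 / δ)⌉₊ with hP
  refine ⟨K ^ P, one_le_pow₀ hK1, fun n hn => ?_⟩
  have hprime : ∀ p ∈ n.primeFactors, ((n.factorization p + 1 : ℕ) : ℝ) ≤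
      (if p < P then K else 1) * ((p : ℝ) ^ n.factorization p) ^ δ := by
    intro p hp
    have hp2 : (2 : ℝ) ≤ p := by exact_mod_cast (Nat.prime_of_mem_primeFactors hp).two_le
    set e := n.factorization p
    have hrw : ((p : ℝ) ^ e) ^ δ = ((p : ℝ) ^ δ) ^ e := by
      rw [← Real.rpow_natCast, ← Real.rpow_mul (by positivity), mul_comm, Real.rpow_mul (by positivity),
        Real.rpow_natCast]
    push_cast
    split_ifs with h
    · refine (add_one_le_mul_two_rpow hδ e).trans (mul_le_mul_of_nonneg_left ?_ (by positivity))
      rw [hrw, Real.rpow_mul zero_le_two, Real.rpow_natCast]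
      gcongr
    · have h1 : (2 : ℝ) ^ (1 / δ) ≤ p := (Nat.le_ceil _).trans (by exact_mod_cast not_lt.1 h)
      have h2 : (2 : ℝ) ≤ (p : ℝ) ^ δ := by
        calc (2 : ℝ) = ((2 : ℝ) ^ (1 / δ)) ^ δ := by
              rw [← Real.rpow_mul zero_le_two, one_div_mul_cancel hδ.ne', Real.rpow_one]
          _ ≤ _ := by gcongr
      rw [hrw, one_mul]
      calc (e + 1 : ℝ) ≤ 2 ^ e := by exact_mod_cast Nat.lt_two_pow_self
        _ ≤ _ := by gcongr
  rw [Nat.card_divisors hn, Nat.cast_prod]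
  calc ∏ p ∈ n.primeFactors, ((n.factorization p + 1 : ℕ) : ℝ)
      ≤ ∏ p ∈ n.primeFactors, (if p < P then K else 1) * ((p : ℝ) ^ n.factorization p) ^ δ :=
        Finset.prod_le_prod (fun _ _ => by positivity) hprime
    _ = (∏ p ∈ n.primeFactors, (if p < P then K else 1)) * (n : ℝ) ^ δ := by
        rw [Finset.prod_mul_distrib, Real.finsetProd_rpow _ _ fun _ _ => by positivity]
        congr 2
        conv_rhs => rw [← Nat.prod_factorization_pow_eq_self hn]
        simp [Finsupp.prod]
    _ ≤ K ^ P * (n : ℝ) ^ δ := by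
        refine mul_le_mul_of_nonneg_right ?_ (by positivity)
        rw [Finset.prod_ite, Finset.prod_const, Finset.prod_const_one, mul_one]
        refine pow_le_pow_right₀ hK1 ?_
        calc _ ≤ (Finset.range P).card := Finset.card_le_card fun p hp => by
              simpa using (Finset.mem_filter.1 hp).2
          _ = P := Finset.card_range P

end DivisorBound

/-! ### Additive energy and its control of sums of two functions. -/

section Energy

/-- The number of pairs in `X` on which `u` takes equal values. -/
def collisions {ι : Type*} (X : Finset ι) (u : ι → ℤ) : ℕ :=
  ((X ×ˢ X).filter fun x => u x.1 = u x.2).card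

lemma card_filter_eq_sum_mul {ι κ : Type*} {X : Finset ι} (Y : Finset κ) {u : ι → ℤ} (w : κ → ℤ)
    {T : Finset ℤ} (hu : ∀ x ∈ X, u x ∈ T) :
    ((X ×ˢ Y).filter fun x => u x.1 = w x.2).card =
      ∑ i ∈ T, (X.filter fun x => u x = i).card * (Y.filter fun y => w y = i).card := by
  classical
  rw [Finset.card_eq_sum_card_fiberwise (f := fun x : ι × κ => u x.1) (t := T)]
  · refine Finset.sum_congr rfl fun i _ => ?_
    rw [← Finset.card_product]
    congr 1
    ext ⟨x, y⟩
    simp only [Finset.mem_filter, Finset.mem_product]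
    constructor
    · rintro ⟨⟨⟨hx, hy⟩, h⟩, h'⟩
      exact ⟨⟨hx, h'⟩, hy, h ▸ h'⟩
    · rintro ⟨⟨hx, h⟩, hy, h'⟩
      exact ⟨⟨⟨hx, hy⟩, h.trans h'.symm⟩, h⟩
  · intro x hx
    exact hu _ (Finset.mem_product.1 (Finset.mem_filter.1 hx).1).1

/-- The count is `∑ aᵢ bᵢ` with `aᵢ`, `bᵢ` the fibre sizes of `u` and `s - v`, while the collisions
are `∑ aᵢ²` and `∑ bᵢ²`. The weight `lam` in AM-GM stays free so as to balance energies of different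
size. -/
lemma two_mul_card_filter_add_eq_le {ι κ : Type*} (X : Finset ι) (Y : Finset κ) (u : ι → ℤ)
    (v : κ → ℤ) (s : ℤ) {lam : ℝ} (hlam : 0 < lam) :
    2 * (((X ×ˢ Y).filter fun x => u x.1 + v x.2 = s).card : ℝ) ≤
      lam * collisions X u + lam⁻¹ * collisions Y v := by
  classical
  set T := X.image u ∪ Y.image fun y => s - v y with hT
  have hu : ∀ x ∈ X, u x ∈ T := fun x hx =>
    Finset.mem_union_left _ (Finset.mem_image_of_mem _ hx)
  have hv : ∀ y ∈ Y, s - v y ∈ T := fun y hy =>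
    Finset.mem_union_right _ (Finset.mem_image_of_mem (fun y => s - v y) hy)
  have e1 : (X ×ˢ Y).filter (fun x => u x.1 + v x.2 = s) =
      (X ×ˢ Y).filter fun x => u x.1 = s - v x.2 :=
    Finset.filter_congr fun x _ => eq_sub_iff_add_eq.symm
  have e2 : collisions Y v = ((Y ×ˢ Y).filter fun y => s - v y.1 = s - v y.2).card := by
    simp [collisions]
  rw [e1, e2, collisions, card_filter_eq_sum_mul Y (fun y => s - v y) hu, card_filter_eq_sum_mul X u hu,
    card_filter_eq_sum_mul Y (fun y => s - v y) hv]
  push_cast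
  rw [Finset.mul_sum, Finset.mul_sum, Finset.mul_sum, ← Finset.sum_add_distrib]
  refine Finset.sum_le_sum fun i _ => ?_
  set a : ℝ := ((X.filter fun x => u x = i).card : ℝ)
  set b : ℝ := ((Y.filter fun y => s - v y = i).card : ℝ)
  have h : lam * (a * a) + lam⁻¹ * (b * b) - 2 * (a * b) = lam⁻¹ * (lam * a - b) ^ 2 := by
    field_simp
    ring
  have : 0 ≤ lam⁻¹ * (lam * a - b) ^ 2 := by positivity
  linarith

/-- The number of solutions of `A x + B y ∈ [a, a + K]` is controlled by the collisions of the
integer parts of `A` and of `B`. -/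
lemma two_mul_card_le_collisions {ι κ : Type*} (X : Finset ι) (Y : Finset κ) (A : ι → ℝ)
    (B : κ → ℝ) (a : ℝ) (K : ℕ) {lam : ℝ} (hlam : 0 < lam) (S : Finset (ι × κ))
    (hS : ∀ x ∈ S, x.1 ∈ X ∧ x.2 ∈ Y ∧ A x.1 + B x.2 ∈ Set.Icc a (a + K)) :
    2 * (S.card : ℝ) ≤ (K + 2) * (lam * collisions X (fun x => ⌊A x⌋) +
      lam⁻¹ * collisions Y fun y => ⌊B y⌋) := by
  classical
  -- The two floors lose less than 2 altogether, so their sum takes at most `K + 2` values.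
  obtain ⟨I, hI⟩ : ∃ I, I = Finset.Icc (⌊a⌋ - 1) (⌊a⌋ + K) := ⟨_, rfl⟩
  have hIcard : I.card = K + 2 := by
    rw [hI, Int.card_Icc]
    omega
  have hsub : S ⊆ I.biUnion fun s =>
      (X ×ˢ Y).filter fun x => ⌊A x.1⌋ + ⌊B x.2⌋ = s := by
    intro x hx
    obtain ⟨h1, h2, h3, h4⟩ := hS x hx
    simp only [Finset.mem_biUnion, Finset.mem_filter, Finset.mem_product, hI, Finset.mem_Icc]
    refine ⟨_, ⟨?_, ?_⟩, ⟨h1, h2⟩, rfl⟩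
    · have : ⌊a⌋ < ⌊A x.1⌋ + ⌊B x.2⌋ + 2 := by
        rw [Int.floor_lt]
        push_cast
        linarith [Int.lt_floor_add_one (A x.1), Int.lt_floor_add_one (B x.2)]
      omega
    · have : ⌊A x.1⌋ + ⌊B x.2⌋ - K ≤ ⌊a⌋ := by
        rw [Int.le_floor]
        push_cast
        linarith [Int.floor_le (A x.1), Int.floor_le (B x.2)]
      omega
  have h1 : (S.card : ℝ) ≤ ∑ s ∈ I,
      (((X ×ˢ Y).filter fun x => ⌊A x.1⌋ + ⌊B x.2⌋ = s).card : ℝ) := by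
    rw [← Nat.cast_sum]
    exact Nat.cast_le.2 ((Finset.card_le_card hsub).trans Finset.card_biUnion_le)
  have h2 := Finset.sum_le_card_nsmul I _ _ fun s _ =>
    two_mul_card_filter_add_eq_le X Y (fun x => ⌊A x⌋) (fun y => ⌊B y⌋) s hlam
  rw [hIcard, nsmul_eq_mul, ← Finset.mul_sum, Nat.cast_add, Nat.cast_ofNat] at h2
  exact (mul_le_mul_of_nonneg_left h1 zero_le_two).trans h2

/-- Multiplication by `θ ≥ 1` keeps integers at distance at least 1. This makes the counts
independent of the arithmetic of `θ`. -/
lemma eq_of_floor_mul_eq {θ : ℝ} (hθ : 1 ≤ θ) {m n : ℤ} (h : ⌊θ * m⌋ = ⌊θ * n⌋) : m = n := by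
  have h1 := Int.abs_sub_lt_one_of_floor_eq_floor h
  rw [← mul_sub, abs_mul, abs_of_nonneg (by linarith)] at h1
  have h2 : |(m : ℝ) - n| < 1 := lt_of_le_of_lt (le_mul_of_one_le_left (abs_nonneg _) hθ) h1
  have h3 : |m - n| < 1 := by exact_mod_cast h2
  have := Int.abs_lt_one_iff.1 h3
  omega

lemma collisions_mul_sq_le {θ : ℝ} (hθ : 1 ≤ θ) (J : Finset ℤ) :
    collisions J (fun m => ⌊θ * (m : ℝ) ^ 2⌋) ≤ 2 * J.card := by
  classical
  have hsub : (J ×ˢ J).filter (fun x => ⌊θ * (x.1 : ℝ) ^ 2⌋ = ⌊θ * (x.2 : ℝ) ^ 2⌋) ⊆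
      J.image (fun m => (m, m)) ∪ J.image fun m => (m, -m) := by
    rintro ⟨m, n⟩ h
    simp only [Finset.mem_filter, Finset.mem_product, Finset.mem_union, Finset.mem_image,
      Prod.mk.injEq] at h ⊢
    have h1 : m ^ 2 = n ^ 2 := eq_of_floor_mul_eq hθ (by push_cast; exact h.2)
    rcases sq_eq_sq_iff_eq_or_eq_neg.1 h1 with h2 | h2
    · exact Or.inl ⟨m, h.1.1, rfl, h2⟩
    · exact Or.inr ⟨m, h.1.1, rfl, by omega⟩
  refine (Finset.card_le_card hsub).trans ((Finset.card_union_le _ _).trans ?_)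
  have h1 := Finset.card_image_le (s := J) (f := fun m => (m, m))
  have h2 := Finset.card_image_le (s := J) (f := fun m => (m, -m))
  omega

end Energy

/-! ### The equation `m² - n² = k² - l²` in an interval, uniformly in its centre. -/

section SquareDifferences

/-- The integers at distance at most `L` from `c`. -/
noncomputable def intBall (c : ℤ) (L : ℕ) : Finset ℤ := Finset.Icc (c - L) (c + L)

lemma mem_intBall {c : ℤ} {L : ℕ} {m : ℤ} : m ∈ intBall c L ↔ c - L ≤ m ∧ m ≤ c + L :=
  Finset.mem_Icc

lemma card_intBall_le (c : ℤ) {L : ℕ} (hL : 1 ≤ L) : (intBall c L).card ≤ 3 * L := by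
  rw [intBall, Int.card_Icc]
  omega

/-- Expanding about `c`, the linear part `2 c (m - n - k + l)` equals a combination of squares of
size at most `2 L²`. As `|c| > L²`, this forces `m - n = k - l`, and dividing by it gives `m + n = k
+ l`. -/
lemma card_sq_sub_sq_eq_le_of_far {c : ℤ} {L : ℕ} (hc : (L : ℤ) ^ 2 < |c|) {m n : ℤ}
    (hm : m ∈ intBall c L) (hn : n ∈ intBall c L) (hmn : m ^ 2 - n ^ 2 ≠ 0) :
    ((intBall c L ×ˢ intBall c L).filter fun x => m ^ 2 - n ^ 2 = x.1 ^ 2 - x.2 ^ 2).card ≤ 1 := by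
  have hsq : ∀ k ∈ intBall c L, 0 ≤ (k - c) ^ 2 ∧ (k - c) ^ 2 ≤ (L : ℤ) ^ 2 := by
    intro k hk
    rw [mem_intBall] at hk
    exact ⟨sq_nonneg _, by nlinarith⟩
  have key : ∀ k ∈ intBall c L, ∀ l ∈ intBall c L, m ^ 2 - n ^ 2 = k ^ 2 - l ^ 2 →
      m = k ∧ n = l := by
    intro k hk l hl h
    have hz : m - n - k + l = 0 := by
      by_contra hz
      have h1 : 2 * c * (m - n - k + l) =
          (k - c) ^ 2 - (l - c) ^ 2 - (m - c) ^ 2 + (n - c) ^ 2 := by linear_combination h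
      have h2 : |2 * c * (m - n - k + l)| ≤ 2 * (L : ℤ) ^ 2 := by
        rw [h1, abs_le]
        have := hsq k hk
        have := hsq l hl
        have := hsq m hm
        have := hsq n hn
        constructor <;> linarith
      rw [abs_mul, abs_mul, abs_two] at h2
      have h3 : 1 ≤ |m - n - k + l| := Int.one_le_abs hz
      nlinarith [abs_nonneg c]
    have hne : m - n ≠ 0 := fun h0 => hmn (by rw [sq_sub_sq, h0, mul_zero])
    have h4 : (m - n) * (m + n - (k + l)) = 0 := by
      have : k - l = m - n := by omega
      linear_combination h + (k + l) * this
    have h5 := (mul_eq_zero.1 h4).resolve_left hne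
    constructor <;> omega
  refine Finset.card_le_one.2 fun x hx y hy => ?_
  simp only [Finset.mem_filter, Finset.mem_product] at hx hy
  have h1 := key _ hx.1.1 _ hx.1.2 hx.2
  have h2 := key _ hy.1.1 _ hy.1.2 hy.2
  exact Prod.ext (h1.1.symm.trans h2.1) (h1.2.symm.trans h2.2)

/-- The difference `x.1 - x.2` is a divisor of `v`, up to sign, and determines the pair. -/
lemma card_sq_sub_sq_eq_le_divisors (X : Finset (ℤ × ℤ)) {v : ℤ} (hv : v ≠ 0) :
    (X.filter fun x => v = x.1 ^ 2 - x.2 ^ 2).card ≤ 2 * v.natAbs.divisors.card := by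
  classical
  set D : Finset ℤ := v.natAbs.divisors.image (fun k : ℕ => (k : ℤ)) ∪
    v.natAbs.divisors.image (fun k : ℕ => -(k : ℤ)) with hD
  have hDcard : D.card ≤ 2 * v.natAbs.divisors.card := by
    have h1 := Finset.card_image_le (s := v.natAbs.divisors) (f := fun k : ℕ => (k : ℤ))
    have h2 := Finset.card_image_le (s := v.natAbs.divisors) (f := fun k : ℕ => -(k : ℤ))
    have h3 := Finset.card_union_le (v.natAbs.divisors.image (fun k : ℕ => (k : ℤ)))
      (v.natAbs.divisors.image (fun k : ℕ => -(k : ℤ)))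
    rw [hD]
    omega
  refine le_trans ?_ hDcard
  refine Finset.card_le_card_of_injOn (fun x => x.1 - x.2) ?_ ?_
  · intro x hx
    have hx' : v = x.1 ^ 2 - x.2 ^ 2 := (Finset.mem_filter.1 hx).2
    have hdvd : x.1 - x.2 ∣ v := by
      rw [hx', sq_sub_sq]
      exact dvd_mul_left _ _
    have hmem : (x.1 - x.2).natAbs ∈ v.natAbs.divisors :=
      Nat.mem_divisors.2 ⟨Int.natAbs_dvd_natAbs.2 hdvd, Int.natAbs_ne_zero.2 hv⟩
    simp only [hD, Finset.coe_union, Finset.coe_image, Set.mem_union, Set.mem_image,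
      Finset.mem_coe]
    rcases Int.natAbs_eq (x.1 - x.2) with h | h
    · exact Or.inl ⟨_, hmem, h.symm⟩
    · exact Or.inr ⟨_, hmem, h.symm⟩
  · intro x hx y hy hxy
    have hx' : v = x.1 ^ 2 - x.2 ^ 2 := (Finset.mem_filter.1 hx).2
    have hy' : v = y.1 ^ 2 - y.2 ^ 2 := (Finset.mem_filter.1 hy).2
    have h0 : x.1 - x.2 = y.1 - y.2 := hxy
    have hne : x.1 - x.2 ≠ 0 := fun h => hv (by rw [hx', sq_sub_sq, h, mul_zero])
    have h1 : (x.1 - x.2) * (x.1 + x.2 - (y.1 + y.2)) = 0 := by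
      linear_combination hy' - hx' - (y.1 + y.2) * h0
    have h2 := (mul_eq_zero.1 h1).resolve_left hne
    exact Prod.ext (by omega) (by omega)

/-- The divisor bound alone would depend on `c`. For `|c| > L²` the solution is unique; otherwise
`|m² - n²| ≤ 8 L³`, whence the exponent `δ / 3`. -/
lemma exists_card_sq_sub_sq_eq_le {δ : ℝ} (hδ : 0 < δ) :
    ∃ C : ℝ, 1 ≤ C ∧ ∀ (c : ℤ) (L : ℕ), 1 ≤ L → ∀ m ∈ intBall c L, ∀ n ∈ intBall c L,
      m ^ 2 - n ^ 2 ≠ 0 →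
      (((intBall c L ×ˢ intBall c L).filter fun x => m ^ 2 - n ^ 2 = x.1 ^ 2 - x.2 ^ 2).card : ℝ) ≤
        C * (L : ℝ) ^ δ := by
  obtain ⟨C, hC, hdiv⟩ := exists_card_divisors_le_rpow (δ := δ / 3) (by positivity)
  have h8 : (1 : ℝ) ≤ 8 ^ (δ / 3) := Real.one_le_rpow (by norm_num) (by positivity)
  have hC' : 1 ≤ 2 * (C * 8 ^ (δ / 3)) := by nlinarith
  refine ⟨2 * (C * 8 ^ (δ / 3)), hC', fun c L hL m hm n hn hmn => ?_⟩
  have hL' : (1 : ℝ) ≤ L := by exact_mod_cast hL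
  rcases lt_or_ge ((L : ℤ) ^ 2) |c| with hc | hc
  · have h1 : (((intBall c L ×ˢ intBall c L).filter
        fun x => m ^ 2 - n ^ 2 = x.1 ^ 2 - x.2 ^ 2).card : ℝ) ≤ 1 := by
      exact_mod_cast card_sq_sub_sq_eq_le_of_far hc hm hn hmn
    have h2 : (1 : ℝ) ≤ (L : ℝ) ^ δ := Real.one_le_rpow hL' hδ.le
    nlinarith
  · have h1 := card_sq_sub_sq_eq_le_divisors (intBall c L ×ˢ intBall c L) hmn
    have h2 := hdiv _ (Int.natAbs_ne_zero.2 hmn)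
    have h3 : ((m ^ 2 - n ^ 2).natAbs : ℝ) ≤ 8 * (L : ℝ) ^ 3 := by
      have : |m ^ 2 - n ^ 2| ≤ 8 * (L : ℤ) ^ 3 := by
        rw [sq_sub_sq, abs_mul]
        rw [mem_intBall] at hm hn
        have hLz : (1 : ℤ) ≤ L := by exact_mod_cast hL
        have ha : |m - n| ≤ 2 * L := abs_le.2 ⟨by linarith, by linarith⟩
        have hb : |m + n| ≤ 4 * (L : ℤ) ^ 2 := by
          have hc' := abs_le.1 hc
          exact abs_le.2 ⟨by nlinarith, by nlinarith⟩
        nlinarith [mul_le_mul hb ha (abs_nonneg _) (by positivity)]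
      rw [Nat.cast_natAbs]
      exact_mod_cast this
    calc _ ≤ 2 * ((m ^ 2 - n ^ 2).natAbs.divisors.card : ℝ) := by exact_mod_cast h1
      _ ≤ 2 * (C * (8 * (L : ℝ) ^ 3) ^ (δ / 3)) := by
          refine mul_le_mul_of_nonneg_left (h2.trans ?_) zero_le_two
          gcongr
      _ = _ := by
          rw [Real.mul_rpow (by norm_num) (by positivity), ← Real.rpow_natCast, ← Real.rpow_mul
            (by positivity), Nat.cast_ofNat, mul_div_cancel₀ _ (three_ne_zero)]
          ring

/-- The number of solutions of `m² - n² = k² - l²` in an interval of length `2 L`. -/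
lemma exists_collisions_sq_sub_sq_le {δ : ℝ} (hδ : 0 < δ) :
    ∃ C : ℝ, 1 ≤ C ∧ ∀ (c : ℤ) (L : ℕ), 1 ≤ L →
      (collisions (intBall c L ×ˢ intBall c L) (fun x => x.1 ^ 2 - x.2 ^ 2) : ℝ) ≤
        C * (L : ℝ) ^ (2 + δ) := by
  classical
  obtain ⟨C, hC, hfib⟩ := exists_card_sq_sub_sq_eq_le hδ
  refine ⟨36 + 9 * C, by linarith, fun c L hL => ?_⟩
  have hL' : (1 : ℝ) ≤ L := by exact_mod_cast hL
  set J := intBall c L with hJ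
  have hJc : (J.card : ℝ) ≤ 3 * L := by exact_mod_cast card_intBall_le c hL
  have hJJ : ((J ×ˢ J).card : ℝ) ≤ 9 * (L : ℝ) ^ 2 := by
    rw [Finset.card_product, Nat.cast_mul]
    nlinarith [mul_le_mul hJc hJc (Nat.cast_nonneg _) (by positivity)]
  set W := ((J ×ˢ J) ×ˢ (J ×ˢ J)).filter
    fun x => x.1.1 ^ 2 - x.1.2 ^ 2 = x.2.1 ^ 2 - x.2.2 ^ 2 with hW
  -- The common value 0 has no divisor bound, but then `n = ±m` and `l = ±k`: four solutions for
  -- each `(m, k)`.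
  have hsplit := W.card_filter_add_card_filter_not fun x => x.1.1 ^ 2 - x.1.2 ^ 2 = 0
  have h0 : ((W.filter fun x => x.1.1 ^ 2 - x.1.2 ^ 2 = 0).card : ℝ) ≤ 4 * (J ×ˢ J).card := by
    have := Finset.card_le_mul_card_image_of_maps_to
      (s := W.filter fun x => x.1.1 ^ 2 - x.1.2 ^ 2 = 0) (t := J ×ˢ J)
      (f := fun x => (x.1.1, x.2.1)) (fun x hx => by
        simp only [hW, Finset.mem_filter, Finset.mem_product] at hx ⊢
        exact ⟨hx.1.1.1.1, hx.1.1.2.1⟩) 4 (fun y _ => by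
        refine le_trans (Finset.card_le_card (t := ({y.1} ×ˢ {y.1, -y.1}) ×ˢ
          ({y.2} ×ˢ {y.2, -y.2})) ?_) ?_
        · rintro x hx
          simp only [hW, Finset.mem_filter, Finset.mem_product, Finset.mem_singleton,
            Finset.mem_insert] at hx ⊢
          obtain ⟨⟨⟨_, h1⟩, h2⟩, rfl⟩ := hx
          have h3 : x.1.2 ^ 2 = x.1.1 ^ 2 := by linarith
          have h4 : x.2.2 ^ 2 = x.2.1 ^ 2 := by linarith
          exact ⟨⟨rfl, sq_eq_sq_iff_eq_or_eq_neg.1 h3⟩, rfl, sq_eq_sq_iff_eq_or_eq_neg.1 h4⟩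
        · simp only [Finset.card_product, Finset.card_singleton, one_mul]
          exact Nat.mul_le_mul (Finset.card_le_two) (Finset.card_le_two))
    exact_mod_cast this
  have h1 : ((W.filter fun x => ¬ x.1.1 ^ 2 - x.1.2 ^ 2 = 0).card : ℝ) ≤
      (J ×ˢ J).card * (C * (L : ℝ) ^ δ) := by
    rw [Finset.card_eq_sum_card_fiberwise (f := fun x => x.1) (t := J ×ˢ J) (fun x hx => by
      simp only [hW, Finset.coe_filter, Finset.mem_filter, Finset.mem_product, Set.mem_ofPred_eq] at hx
      exact Finset.mem_coe.2 (Finset.mem_product.2 hx.1.1.1)), Nat.cast_sum, ← nsmul_eq_mul]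
    refine Finset.sum_le_card_nsmul _ _ _ fun y hy => ?_
    by_cases hy0 : y.1 ^ 2 - y.2 ^ 2 = 0
    · have hempty : (W.filter fun x => ¬ x.1.1 ^ 2 - x.1.2 ^ 2 = 0).filter (fun x => x.1 = y) = ∅ := by
        rw [Finset.filter_eq_empty_iff]
        intro x hx hxy
        refine (Finset.mem_filter.1 hx).2 ?_
        rw [hxy]
        exact hy0
      rw [hempty, Finset.card_empty, Nat.cast_zero]
      positivity
    · rw [Finset.mem_product] at hy
      refine le_trans ?_ (hfib c L hL y.1 hy.1 y.2 hy.2 hy0)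
      refine Nat.cast_le.2 (Finset.card_le_card_of_injOn (fun x => x.2) ?_ ?_)
      · intro x hx
        simp only [hW, Finset.coe_filter, Finset.mem_filter, Finset.mem_product,
          Set.mem_ofPred_eq] at hx ⊢
        obtain ⟨⟨⟨⟨_, h1⟩, h2⟩, _⟩, rfl⟩ := hx
        exact ⟨h1, h2⟩
      · intro x hx x' hx' h
        simp only [Finset.coe_filter, Set.mem_ofPred_eq] at hx hx'
        exact Prod.ext (hx.2.trans hx'.2.symm) h
  have hLδ : (1 : ℝ) ≤ (L : ℝ) ^ δ := Real.one_le_rpow hL' hδ.le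
  have hpow : (L : ℝ) ^ (2 + δ) = (L : ℝ) ^ 2 * (L : ℝ) ^ δ := by
    rw [Real.rpow_add (by positivity), Real.rpow_ofNat]
  have hcol : collisions (J ×ˢ J) (fun x => x.1 ^ 2 - x.2 ^ 2) = W.card := rfl
  rw [hcol, ← hsplit, Nat.cast_add, hpow]
  have hpos : 0 < C * (L : ℝ) ^ δ := by positivity
  have h2 := mul_le_mul_of_nonneg_right hJJ hpos.le
  have h3 : (L : ℝ) ^ 2 ≤ (L : ℝ) ^ 2 * (L : ℝ) ^ δ := le_mul_of_one_le_right (by positivity) hLδ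
  nlinarith

end SquareDifferences

/-! ### Lattice points in shells for `d ≥ 3`. -/

section ShellCount

lemma collisions_mul_le {ι : Type*} {θ : ℝ} (hθ : 1 ≤ θ) (X : Finset ι) (u : ι → ℤ) :
    collisions X (fun x => ⌊θ * (u x : ℝ)⌋) ≤ collisions X u :=
  Finset.card_le_card fun _ hx => Finset.mem_filter.2
    ⟨(Finset.mem_filter.1 hx).1, eq_of_floor_mul_eq hθ (Finset.mem_filter.1 hx).2⟩

/-- A collision puts `θ (m² - k²) + θ' (n² - l²)` in `[-1, 1]`. Regrouping the variables by
coefficient (the map `g`) puts each coefficient in front of an integer, and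
`two_mul_card_le_collisions` then separates the two coefficients. -/
lemma exists_collisions_binary_form_le {δ : ℝ} (hδ : 0 < δ) :
    ∃ C : ℝ, 1 ≤ C ∧ ∀ (θ θ' : ℝ), 1 ≤ θ → 1 ≤ θ' → ∀ (c c' : ℤ) (L : ℕ), 1 ≤ L →
      (collisions (intBall c L ×ˢ intBall c' L)
        (fun x => ⌊θ * (x.1 : ℝ) ^ 2 + θ' * (x.2 : ℝ) ^ 2⌋) : ℝ) ≤ C * (L : ℝ) ^ (2 + δ) := by
  classical
  obtain ⟨C, hC, hcol⟩ := exists_collisions_sq_sub_sq_le hδ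
  refine ⟨4 * C, by linarith, fun θ θ' hθ hθ' c c' L hL => ?_⟩
  set J := intBall c L
  set J' := intBall c' L
  set W := ((J ×ˢ J') ×ˢ (J ×ˢ J')).filter fun x =>
    ⌊θ * (x.1.1 : ℝ) ^ 2 + θ' * (x.1.2 : ℝ) ^ 2⌋ =
      ⌊θ * (x.2.1 : ℝ) ^ 2 + θ' * (x.2.2 : ℝ) ^ 2⌋ with hW
  set g : (ℤ × ℤ) × (ℤ × ℤ) → (ℤ × ℤ) × (ℤ × ℤ) :=
    fun x => ((x.1.1, x.2.1), (x.1.2, x.2.2)) with hg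
  have hginj : Function.Injective g := by
    rintro ⟨⟨a, b⟩, ⟨c, d⟩⟩ ⟨⟨a', b'⟩, ⟨c', d'⟩⟩ h
    simp only [hg, Prod.mk.injEq] at h ⊢
    tauto
  have h1 := two_mul_card_le_collisions (J ×ˢ J) (J' ×ˢ J')
    (fun x => θ * ((x.1 ^ 2 - x.2 ^ 2 : ℤ) : ℝ)) (fun x => θ' * ((x.1 ^ 2 - x.2 ^ 2 : ℤ) : ℝ))
    (-1) 2 one_pos (W.image g) (by
      intro x hx
      obtain ⟨y, hy, rfl⟩ := Finset.mem_image.1 hx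
      simp only [hW, Finset.mem_filter, Finset.mem_product] at hy
      refine ⟨Finset.mem_product.2 ⟨hy.1.1.1, hy.1.2.1⟩,
        Finset.mem_product.2 ⟨hy.1.1.2, hy.1.2.2⟩, ?_⟩
      have h := abs_lt.1 (Int.abs_sub_lt_one_of_floor_eq_floor hy.2)
      simp only [hg]
      push_cast
      constructor <;> linarith [h.1, h.2])
  rw [Finset.card_image_of_injective _ hginj] at h1
  have h2 : (collisions (J ×ˢ J) (fun x => ⌊θ * ((x.1 ^ 2 - x.2 ^ 2 : ℤ) : ℝ)⌋) : ℝ) ≤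
      C * (L : ℝ) ^ (2 + δ) :=
    (Nat.cast_le.2 (collisions_mul_le hθ _ _)).trans (hcol c L hL)
  have h3 : (collisions (J' ×ˢ J') (fun x => ⌊θ' * ((x.1 ^ 2 - x.2 ^ 2 : ℤ) : ℝ)⌋) : ℝ) ≤
      C * (L : ℝ) ^ (2 + δ) :=
    (Nat.cast_le.2 (collisions_mul_le hθ' _ _)).trans (hcol c' L hL)
  have hcW : collisions (J ×ˢ J') (fun x => ⌊θ * (x.1 : ℝ) ^ 2 + θ' * (x.2 : ℝ) ^ 2⌋) = W.card :=
    rfl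
  rw [hcW]
  rw [inv_one, one_mul, one_mul, Nat.cast_ofNat] at h1
  linarith

/-- The cubes of side `2 L` contain `O(L ^ e)` integer points in each shell
`a ≤ ∑ⱼ θⱼ mⱼ² ≤ a + 2`, uniformly in the cube, in the shell and in `9 ≤ θⱼ ≤ 160`. -/
def ShellBound (d : ℕ) (e : ℝ) : Prop :=
  ∃ C : ℝ, 0 < C ∧ ∀ θ : Fin d → ℝ, (∀ j, θ j ∈ Set.Icc (9 : ℝ) 160) →
    ∀ (c : Fin d → ℤ) (L : ℕ), 1 ≤ L → ∀ (a : ℝ) (S : Finset (Fin d → ℤ)),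
      (∀ m ∈ S, (∀ j, m j ∈ intBall (c j) L) ∧
        ∑ j, θ j * (m j : ℝ) ^ 2 ∈ Set.Icc a (a + 2)) → (S.card : ℝ) ≤ C * (L : ℝ) ^ e

lemma ShellBound.mono {d : ℕ} {e e' : ℝ} (h : ShellBound d e) (he : e ≤ e') : ShellBound d e' := by
  obtain ⟨C, hC, h⟩ := h
  refine ⟨C, hC, fun θ hθ c L hL a S hS => (h θ hθ c L hL a S hS).trans ?_⟩
  have hL' : (1 : ℝ) ≤ L := by exact_mod_cast hL
  gcongr

/-- Fixing the first coordinate, in at most `3 L` ways, translates the shell for the others. -/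
lemma ShellBound.succ {d : ℕ} {e : ℝ} (h : ShellBound d e) : ShellBound (d + 1) (e + 1) := by
  classical
  obtain ⟨C, hC, h⟩ := h
  refine ⟨3 * C, by positivity, fun θ hθ c L hL a S hS => ?_⟩
  have hL' : (0 : ℝ) < L := by exact_mod_cast hL
  have hJ : ((intBall (c 0) L).card : ℝ) ≤ 3 * L := by exact_mod_cast card_intBall_le (c 0) hL
  rw [Finset.card_eq_sum_card_fiberwise (f := fun m => m 0) (t := intBall (c 0) L)
    (fun m hm => (hS m hm).1 0), Nat.cast_sum]
  calc _ ≤ (intBall (c 0) L).card • (C * (L : ℝ) ^ e) := by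
        refine Finset.sum_le_card_nsmul _ _ _ fun k _ => ?_
        rw [← Finset.card_image_of_injOn (f := Fin.tail)]
        · refine h (Fin.tail θ) (fun j => hθ _) (Fin.tail c) L hL (a - θ 0 * (k : ℝ) ^ 2) _ ?_
          intro m' hm'
          obtain ⟨m, hm, rfl⟩ := Finset.mem_image.1 hm'
          obtain ⟨hm1, rfl⟩ := Finset.mem_filter.1 hm
          obtain ⟨h1, h2⟩ := hS m hm1
          rw [Fin.sum_univ_succ] at h2
          refine ⟨fun j => h1 j.succ, ?_⟩
          simp only [Fin.tail]
          constructor <;> linarith [h2.1, h2.2]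
        · intro m hm m' hm' hmm
          have h0 : m 0 = m' 0 := (Finset.mem_filter.1 hm).2.trans (Finset.mem_filter.1 hm').2.symm
          rw [← Fin.cons_self_tail m, ← Fin.cons_self_tail m', h0, hmm]
    _ ≤ 3 * L * (C * (L : ℝ) ^ e) := by
        rw [nsmul_eq_mul]
        gcongr
    _ = _ := by
        rw [Real.rpow_add hL', Real.rpow_one]
        ring

/-- Two binary forms, each of energy `O(L ^ (2 + δ))`. -/
lemma shellBound_four {δ : ℝ} (hδ : 0 < δ) : ShellBound 4 (2 + δ) := by
  classical
  obtain ⟨C, hC, hcol⟩ := exists_collisions_binary_form_le hδ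
  refine ⟨4 * C, by linarith, fun θ hθ c L hL a S hS => ?_⟩
  have hθ' : ∀ j, 1 ≤ θ j := fun j => le_trans (by norm_num) (hθ j).1
  set g : (Fin 4 → ℤ) → (ℤ × ℤ) × (ℤ × ℤ) := fun m => ((m 0, m 1), (m 2, m 3)) with hg
  have hginj : Function.Injective g := by
    intro m m' h
    simp only [hg, Prod.mk.injEq] at h
    ext j
    fin_cases j
    exacts [h.1.1, h.1.2, h.2.1, h.2.2]
  have h1 := two_mul_card_le_collisions (intBall (c 0) L ×ˢ intBall (c 1) L)
    (intBall (c 2) L ×ˢ intBall (c 3) L) (fun x => θ 0 * (x.1 : ℝ) ^ 2 + θ 1 * (x.2 : ℝ) ^ 2)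
    (fun x => θ 2 * (x.1 : ℝ) ^ 2 + θ 3 * (x.2 : ℝ) ^ 2) a 2 one_pos (S.image g) (by
      intro x hx
      obtain ⟨m, hm, rfl⟩ := Finset.mem_image.1 hx
      obtain ⟨h1, h2⟩ := hS m hm
      refine ⟨Finset.mem_product.2 ⟨h1 0, h1 1⟩, Finset.mem_product.2 ⟨h1 2, h1 3⟩, ?_⟩
      rw [Fin.sum_univ_four] at h2
      simp only [hg]
      push_cast
      constructor <;> linarith [h2.1, h2.2])
  rw [Finset.card_image_of_injective _ hginj] at h1
  have h2 := hcol _ _ (hθ' 0) (hθ' 1) (c 0) (c 1) L hL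
  have h3 := hcol _ _ (hθ' 2) (hθ' 3) (c 2) (c 3) L hL
  norm_num at h1
  linarith

lemma shellBound_three {δ : ℝ} (hδ : 0 < δ) : ShellBound 3 (3 / 2 + δ) := by
  classical
  obtain ⟨C, hC, hcol⟩ := exists_collisions_binary_form_le hδ
  refine ⟨2 * (6 + C), by linarith, fun θ hθ c L hL a S hS => ?_⟩
  have hL' : (1 : ℝ) ≤ L := by exact_mod_cast hL
  have hLpos : (0 : ℝ) < L := by linarith
  have hθ' : ∀ j, 1 ≤ θ j := fun j => le_trans (by norm_num) (hθ j).1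
  set g : (Fin 3 → ℤ) → ℤ × (ℤ × ℤ) := fun m => (m 0, (m 1, m 2)) with hg
  have hginj : Function.Injective g := by
    intro m m' h
    simp only [hg, Prod.mk.injEq] at h
    ext j
    fin_cases j
    exacts [h.1, h.2.1, h.2.2]
  -- The energies are `O(L)` for one variable and `O(L ^ (2 + δ))` for two; the weight `L ^ (1/2)`
  -- balances them.
  have h1 := two_mul_card_le_collisions (intBall (c 0) L)
    (intBall (c 1) L ×ˢ intBall (c 2) L) (fun x => θ 0 * (x : ℝ) ^ 2)
    (fun x => θ 1 * (x.1 : ℝ) ^ 2 + θ 2 * (x.2 : ℝ) ^ 2) a 2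
    (Real.rpow_pos_of_pos hLpos (1 / 2)) (S.image g) (by
      intro x hx
      obtain ⟨m, hm, rfl⟩ := Finset.mem_image.1 hx
      obtain ⟨h1, h2⟩ := hS m hm
      refine ⟨h1 0, Finset.mem_product.2 ⟨h1 1, h1 2⟩, ?_⟩
      rw [Fin.sum_univ_three] at h2
      simp only [hg]
      push_cast
      constructor <;> linarith [h2.1, h2.2])
  rw [Finset.card_image_of_injective _ hginj] at h1
  have h2 : (collisions (intBall (c 0) L) (fun x => ⌊θ 0 * (x : ℝ) ^ 2⌋) : ℝ) ≤ 6 * L := by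
    have h := collisions_mul_sq_le (hθ' 0) (intBall (c 0) L)
    have h' := card_intBall_le (c 0) hL
    exact_mod_cast (by omega : collisions (intBall (c 0) L) (fun x => ⌊θ 0 * (x : ℝ) ^ 2⌋) ≤ 6 * L)
  have h3 := hcol _ _ (hθ' 1) (hθ' 2) (c 1) (c 2) L hL
  have h4 : (L : ℝ) ^ (1 / 2 : ℝ) * (6 * L) ≤ 6 * (L : ℝ) ^ (3 / 2 + δ) := by
    have : (L : ℝ) ^ (1 / 2 : ℝ) * L = (L : ℝ) ^ (3 / 2 : ℝ) := by
      rw [← Real.rpow_add_one hLpos.ne']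
      norm_num
    rw [mul_left_comm, this]
    gcongr
    linarith
  have h5 : ((L : ℝ) ^ (1 / 2 : ℝ))⁻¹ * (C * (L : ℝ) ^ (2 + δ)) = C * (L : ℝ) ^ (3 / 2 + δ) := by
    rw [← Real.rpow_neg hLpos.le, mul_left_comm, ← Real.rpow_add hLpos]
    congr 2
    ring
  have hpos : (0 : ℝ) < (L : ℝ) ^ (1 / 2 : ℝ) := by positivity
  have h6 := mul_le_mul_of_nonneg_left h2 hpos.le
  have h7 := mul_le_mul_of_nonneg_left h3 (inv_pos.2 hpos).le
  push_cast at h1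
  linarith

lemma shellBound_of_four_le {d : ℕ} (hd : 4 ≤ d) {δ : ℝ} (hδ : 0 < δ) :
    ShellBound d (d - 2 + δ) := by
  induction d, hd using Nat.le_induction with
  | base => exact (shellBound_four hδ).mono (by norm_num)
  | succ d _ ih => exact ih.succ.mono (by push_cast; linarith)

end ShellCount

/-! ### Lattice points in planar shells, by areas of triangles. -/

section PlanarShell

/-- Three non-collinear points `u`, `u + a`, `u + b` near a circle about the origin form a triangle
whose area is controlled by the radius and the side lengths. The plane carries the quadratic form
`θ₁ x² + θ₂ y²`. -/
lemma det_sq_mul_le {θ₁ θ₂ u₁ u₂ a₁ a₂ b₁ b₂ D : ℝ} (h₁ : 0 ≤ θ₁) (h₂ : 0 ≤ θ₂)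
    (ha : θ₁ * a₁ ^ 2 + θ₂ * a₂ ^ 2 ≤ D) (hb : θ₁ * b₁ ^ 2 + θ₂ * b₂ ^ 2 ≤ D)
    (hua : |θ₁ * u₁ * a₁ + θ₂ * u₂ * a₂| ≤ D) (hub : |θ₁ * u₁ * b₁ + θ₂ * u₂ * b₂| ≤ D) :
    θ₁ * θ₂ * (a₁ * b₂ - a₂ * b₁) ^ 2 * (θ₁ * u₁ ^ 2 + θ₂ * u₂ ^ 2) ≤ 4 * D ^ 3 := by
  set s := θ₁ * u₁ * a₁ + θ₂ * u₂ * a₂ with hs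
  set t := θ₁ * u₁ * b₁ + θ₂ * u₂ * b₂ with ht
  have hD : 0 ≤ D := (abs_nonneg _).trans hua
  have hs2 : s ^ 2 ≤ D ^ 2 := sq_le_sq' (abs_le.1 hua).1 (abs_le.1 hua).2
  have ht2 : t ^ 2 ≤ D ^ 2 := sq_le_sq' (abs_le.1 hub).1 (abs_le.1 hub).2
  -- The vector `s b - t a` is orthogonal to `u` for the form, and its length is that of `u` times
  -- the area of the parallelogram spanned by `a` and `b`.
  have key : θ₁ * θ₂ * (a₁ * b₂ - a₂ * b₁) ^ 2 * (θ₁ * u₁ ^ 2 + θ₂ * u₂ ^ 2) =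
      θ₁ * (s * b₁ - t * a₁) ^ 2 + θ₂ * (s * b₂ - t * a₂) ^ 2 := by
    rw [hs, ht]
    ring
  have h3 : θ₁ * (s * b₁ - t * a₁) ^ 2 ≤ θ₁ * (2 * (s * b₁) ^ 2 + 2 * (t * a₁) ^ 2) :=
    mul_le_mul_of_nonneg_left (by nlinarith [sq_nonneg (s * b₁ + t * a₁)]) h₁
  have h4 : θ₂ * (s * b₂ - t * a₂) ^ 2 ≤ θ₂ * (2 * (s * b₂) ^ 2 + 2 * (t * a₂) ^ 2) :=
    mul_le_mul_of_nonneg_left (by nlinarith [sq_nonneg (s * b₂ + t * a₂)]) h₂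
  have hpa : 0 ≤ θ₁ * a₁ ^ 2 + θ₂ * a₂ ^ 2 := by positivity
  have hpb : 0 ≤ θ₁ * b₁ ^ 2 + θ₂ * b₂ ^ 2 := by positivity
  have h5 := mul_le_mul hs2 hb hpb (sq_nonneg D)
  have h6 := mul_le_mul ht2 ha hpa (sq_nonneg D)
  rw [key]
  nlinarith

/-- A line contains at most two lattice points of a thin shell. -/
lemma not_three_collinear {θ₁ θ₂ x : ℝ} (h₁ : 9 ≤ θ₁) (h₂ : 9 ≤ θ₂) {u₁ u₂ a₁ a₂ b₁ b₂ : ℤ}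
    (hdet : a₁ * b₂ - a₂ * b₁ = 0) (ha : a₁ ≠ 0) (hb : b₁ ≠ 0) (hab : a₁ ≠ b₁)
    (hu : θ₁ * (u₁ : ℝ) ^ 2 + θ₂ * (u₂ : ℝ) ^ 2 ∈ Set.Icc x (x + 2))
    (hua : θ₁ * (u₁ + a₁ : ℝ) ^ 2 + θ₂ * (u₂ + a₂ : ℝ) ^ 2 ∈ Set.Icc x (x + 2))
    (hub : θ₁ * (u₁ + b₁ : ℝ) ^ 2 + θ₂ * (u₂ + b₂ : ℝ) ^ 2 ∈ Set.Icc x (x + 2)) : False := by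
  have ha' : (a₁ : ℝ) ≠ 0 := by exact_mod_cast ha
  have ha1 : (1 : ℝ) ≤ |(a₁ : ℝ)| := by exact_mod_cast Int.one_le_abs ha
  have hb1 : (1 : ℝ) ≤ |(b₁ : ℝ)| := by exact_mod_cast Int.one_le_abs hb
  have hab1 : (1 : ℝ) ≤ |(b₁ : ℝ) - a₁| := by
    exact_mod_cast Int.one_le_abs (sub_ne_zero.2 hab.symm)
  obtain ⟨r, hr⟩ : ∃ r : ℝ, (a₂ : ℝ) = r * a₁ := ⟨a₂ / a₁, by field_simp⟩
  have hdet' : (a₁ : ℝ) * b₂ - a₂ * b₁ = 0 := by exact_mod_cast hdet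
  have hr' : (b₂ : ℝ) = r * b₁ := by
    refine mul_left_cancel₀ ha' ?_
    rw [hr] at hdet'
    linarith
  rw [hr] at hua
  rw [hr'] at hub
  set f0 := θ₁ * (u₁ : ℝ) ^ 2 + θ₂ * (u₂ : ℝ) ^ 2 with hf0
  set fa := θ₁ * (u₁ + a₁ : ℝ) ^ 2 + θ₂ * (u₂ + r * a₁ : ℝ) ^ 2 with hfa
  set fb := θ₁ * (u₁ + b₁ : ℝ) ^ 2 + θ₂ * (u₂ + r * b₁ : ℝ) ^ 2 with hfb
  -- On the line the form is quadratic with leading coefficient at least 9. Its second difference is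
  -- too large for three values in an interval of length 2.
  have key : (a₁ : ℝ) * (fb - f0) - b₁ * (fa - f0) =
      (θ₁ + θ₂ * r ^ 2) * (a₁ * b₁ * (b₁ - a₁)) := by
    rw [hf0, hfa, hfb]
    ring
  have hκ : 9 ≤ θ₁ + θ₂ * r ^ 2 := by nlinarith [sq_nonneg r]
  have hsa : |fa - f0| ≤ 2 := abs_le.2 ⟨by linarith [hu.2, hua.1], by linarith [hu.1, hua.2]⟩
  have hsb : |fb - f0| ≤ 2 := abs_le.2 ⟨by linarith [hu.2, hub.1], by linarith [hu.1, hub.2]⟩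
  have hup : |(a₁ : ℝ) * (fb - f0) - b₁ * (fa - f0)| ≤ |(a₁ : ℝ)| * 2 + |(b₁ : ℝ)| * 2 := by
    refine (abs_sub _ _).trans ?_
    rw [abs_mul, abs_mul]
    gcongr
  rw [key, abs_mul, abs_mul, abs_mul, abs_of_nonneg (by linarith : 0 ≤ θ₁ + θ₂ * r ^ 2)] at hup
  have h1 : |(a₁ : ℝ)| * |(b₁ : ℝ)| ≤ |(a₁ : ℝ)| * |(b₁ : ℝ)| * |(b₁ : ℝ) - a₁| :=
    le_mul_of_one_le_right (by positivity) hab1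
  have h2 : 9 * (|(a₁ : ℝ)| * |(b₁ : ℝ)|) ≤
      (θ₁ + θ₂ * r ^ 2) * (|(a₁ : ℝ)| * |(b₁ : ℝ)| * |(b₁ : ℝ) - a₁|) :=
    mul_le_mul hκ h1 (by positivity) (by linarith)
  nlinarith

/-- The part of the shell `x ≤ θ₁ m₁² + θ₂ m₂² ≤ x + 2` which is a graph over the first axis. -/
def InSector (θ₁ θ₂ x : ℝ) (m : ℤ × ℤ) : Prop :=
  0 ≤ m.2 ∧ θ₁ * (m.1 : ℝ) ^ 2 ≤ θ₂ * (m.2 : ℝ) ^ 2 ∧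
    θ₁ * (m.1 : ℝ) ^ 2 + θ₂ * (m.2 : ℝ) ^ 2 ∈ Set.Icc x (x + 2)

/-- In the coordinates scaled by `√θ₁`, `√θ₂` the sector is `|y₁| ≤ y₂`, and `y₂ ≥ 1` because `x ≥
2`. Factoring differences of squares gives `|Δy₂| ≤ 1 + |Δy₁|`. As the scaled lattice has steps of
at least 3, `Δy₁` is nonzero and the 1 is absorbed. -/
lemma InSector.slope {θ₁ θ₂ x : ℝ} (h₁ : 9 ≤ θ₁) (h₂ : 9 ≤ θ₂) (hx : 2 ≤ x) {m n : ℤ × ℤ}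
    (hm : InSector θ₁ θ₂ x m) (hn : InSector θ₁ θ₂ x n) (hmn : m ≠ n) :
    n.1 - m.1 ≠ 0 ∧
      θ₂ * ((n.2 : ℝ) - m.2) ^ 2 ≤ 4 * (θ₁ * ((n.1 : ℝ) - m.1) ^ 2) := by
  obtain ⟨hm0, hm1, hm2, hm3⟩ := hm
  obtain ⟨hn0, hn1, hn2, hn3⟩ := hn
  have hm0' : (0 : ℝ) ≤ m.2 := by exact_mod_cast hm0
  have hn0' : (0 : ℝ) ≤ n.2 := by exact_mod_cast hn0
  obtain ⟨r₁, hr₁, rfl⟩ : ∃ r : ℝ, 0 ≤ r ∧ θ₁ = r ^ 2 :=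
    ⟨√θ₁, Real.sqrt_nonneg _, (Real.sq_sqrt (by linarith)).symm⟩
  obtain ⟨r₂, hr₂, rfl⟩ : ∃ r : ℝ, 0 ≤ r ∧ θ₂ = r ^ 2 :=
    ⟨√θ₂, Real.sqrt_nonneg _, (Real.sq_sqrt (by linarith)).symm⟩
  have hr₁3 : 3 ≤ r₁ := by nlinarith
  have hr₂3 : 3 ≤ r₂ := by nlinarith
  simp only [← mul_pow] at *
  have hy2 : 0 ≤ r₂ * m.2 := by positivity
  have hz2 : 0 ≤ r₂ * n.2 := by positivity
  have hy1 : |r₁ * m.1| ≤ r₂ * m.2 := abs_le_of_sq_le_sq hm1 hy2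
  have hz1 : |r₁ * n.1| ≤ r₂ * n.2 := abs_le_of_sq_le_sq hn1 hz2
  have hy : 1 ≤ r₂ * m.2 := by nlinarith
  have hz : 1 ≤ r₂ * n.2 := by nlinarith
  have hsum : |r₁ * (n.1 : ℝ) + r₁ * m.1| ≤ r₂ * n.2 + r₂ * m.2 :=
    (abs_add_le _ _).trans (by linarith)
  have hlip : |r₂ * (n.2 : ℝ) - r₂ * m.2| ≤ 1 + |r₁ * (n.1 : ℝ) - r₁ * m.1| := by
    have e1 : |(r₂ * (n.2 : ℝ)) ^ 2 - (r₂ * m.2) ^ 2| ≤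
        2 + |(r₁ * (n.1 : ℝ)) ^ 2 - (r₁ * m.1) ^ 2| := by
      have := neg_abs_le ((r₁ * (n.1 : ℝ)) ^ 2 - (r₁ * m.1) ^ 2)
      have := le_abs_self ((r₁ * (n.1 : ℝ)) ^ 2 - (r₁ * m.1) ^ 2)
      exact abs_le.2 ⟨by linarith, by linarith⟩
    rw [sq_sub_sq, sq_sub_sq, abs_mul, abs_mul, abs_of_nonneg (by linarith : 0 ≤ r₂ * (n.2 : ℝ) +
      r₂ * m.2)] at e1
    have e2 := mul_le_mul_of_nonneg_right hsum (abs_nonneg (r₁ * (n.1 : ℝ) - r₁ * m.1))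
    by_contra! hcon
    have e3 : 0 < r₂ * (n.2 : ℝ) + r₂ * m.2 := by linarith
    have := mul_lt_mul_of_pos_left hcon e3
    nlinarith
  rw [← mul_sub, ← mul_sub, abs_mul, abs_mul, abs_of_nonneg hr₁, abs_of_nonneg hr₂] at hlip
  have hne : n.1 - m.1 ≠ 0 := by
    intro h0
    have h0' : (n.1 : ℝ) - m.1 = 0 := by exact_mod_cast h0
    rw [h0', abs_zero, mul_zero, add_zero] at hlip
    have h3 : |(n.2 : ℝ) - m.2| < 1 := by nlinarith [abs_nonneg ((n.2 : ℝ) - m.2)]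
    have h4 : |n.2 - m.2| < 1 := by exact_mod_cast h3
    have h5 := Int.abs_lt_one_iff.1 h4
    exact hmn (Prod.ext (by omega) (by omega))
  refine ⟨hne, ?_⟩
  have h6 : (1 : ℝ) ≤ |(n.1 : ℝ) - m.1| := by exact_mod_cast Int.one_le_abs hne
  have h7 : r₂ * |(n.2 : ℝ) - m.2| ≤ 2 * (r₁ * |(n.1 : ℝ) - m.1|) := by nlinarith
  have h8 := pow_le_pow_left₀ (by positivity) h7 2
  rw [mul_pow, mul_pow, mul_pow, sq_abs, sq_abs] at h8
  rw [mul_pow, mul_pow]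
  linarith

/-- Three lattice points of a sector cannot be too close to each other. -/
lemma InSector.le_of_three {θ₁ θ₂ x w : ℝ} (h₁ : θ₁ ∈ Set.Icc (9 : ℝ) 160)
    (h₂ : θ₂ ∈ Set.Icc (9 : ℝ) 160) (hx : 2 ≤ x) {u v z : ℤ × ℤ} (hu : InSector θ₁ θ₂ x u)
    (hv : InSector θ₁ θ₂ x v) (hz : InSector θ₁ θ₂ x z) (huv : u ≠ v) (huz : u ≠ z) (hvz : v ≠ z)
    (hwv : |(v.1 : ℝ) - u.1| ≤ w) (hwz : |(z.1 : ℝ) - u.1| ≤ w) :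
    81 * x ≤ 4 * (800 * w ^ 2) ^ 3 := by
  obtain ⟨hv0, hv1⟩ := hu.slope h₁.1 h₂.1 hx hv huv
  obtain ⟨hz0, hz1⟩ := hu.slope h₁.1 h₂.1 hx hz huz
  obtain ⟨hvz0, -⟩ := hv.slope h₁.1 h₂.1 hx hz hvz
  have hw1 : 1 ≤ w := by
    have : (1 : ℝ) ≤ |(v.1 : ℝ) - u.1| := by exact_mod_cast Int.one_le_abs hv0
    linarith
  have hdet : (v.1 - u.1) * (z.2 - u.2) - (v.2 - u.2) * (z.1 - u.1) ≠ 0 := by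
    intro hdet
    have e1 := hu.2.2
    have e2 := hv.2.2
    have e3 := hz.2.2
    refine not_three_collinear h₁.1 h₂.1 hdet hv0 hz0 (by omega) e1 ?_ ?_
    · push_cast
      simpa using e2
    · push_cast
      simpa using e3
  have hdet1 : (1 : ℝ) ≤ (((v.1 : ℝ) - u.1) * (z.2 - u.2) - (v.2 - u.2) * (z.1 - u.1)) ^ 2 := by
    have := Int.one_le_abs hdet
    rw [one_le_sq_iff_one_le_abs]
    exact_mod_cast this
  -- `800 = 160 + 4 * 160` by the slope bound. Polarization bounds the inner product with `u`, since
  -- `u` and `y` lie in the same shell.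
  have hq : ∀ y : ℤ × ℤ, InSector θ₁ θ₂ x y → |(y.1 : ℝ) - u.1| ≤ w →
      θ₂ * ((y.2 : ℝ) - u.2) ^ 2 ≤ 4 * (θ₁ * ((y.1 : ℝ) - u.1) ^ 2) →
      θ₁ * ((y.1 : ℝ) - u.1) ^ 2 + θ₂ * ((y.2 : ℝ) - u.2) ^ 2 ≤ 800 * w ^ 2 ∧
        |θ₁ * u.1 * ((y.1 : ℝ) - u.1) + θ₂ * u.2 * ((y.2 : ℝ) - u.2)| ≤ 800 * w ^ 2 := by
    intro y hy hyw hy1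
    have e1 : ((y.1 : ℝ) - u.1) ^ 2 ≤ w ^ 2 := sq_le_sq' (abs_le.1 hyw).1 (abs_le.1 hyw).2
    have e2 : θ₁ * ((y.1 : ℝ) - u.1) ^ 2 ≤ 160 * w ^ 2 :=
      mul_le_mul h₁.2 e1 (sq_nonneg _) (by norm_num)
    have e3 : θ₁ * ((y.1 : ℝ) - u.1) ^ 2 + θ₂ * ((y.2 : ℝ) - u.2) ^ 2 ≤ 800 * w ^ 2 := by linarith
    have e0 : 0 ≤ θ₁ * ((y.1 : ℝ) - u.1) ^ 2 + θ₂ * ((y.2 : ℝ) - u.2) ^ 2 := by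
      have := h₁.1
      have := h₂.1
      positivity
    refine ⟨e3, ?_⟩
    have e4 : 2 * (θ₁ * u.1 * ((y.1 : ℝ) - u.1) + θ₂ * u.2 * ((y.2 : ℝ) - u.2)) =
        (θ₁ * (y.1 : ℝ) ^ 2 + θ₂ * (y.2 : ℝ) ^ 2) - (θ₁ * (u.1 : ℝ) ^ 2 + θ₂ * (u.2 : ℝ) ^ 2) -
          (θ₁ * ((y.1 : ℝ) - u.1) ^ 2 + θ₂ * ((y.2 : ℝ) - u.2) ^ 2) := by ring
    have e5 : 1 ≤ w ^ 2 := by nlinarith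
    have := hy.2.2.1
    have := hy.2.2.2
    have := hu.2.2.1
    have := hu.2.2.2
    exact abs_le.2 ⟨by linarith, by linarith⟩
  obtain ⟨hqv, hiv⟩ := hq v hv hwv hv1
  obtain ⟨hqz, hiz⟩ := hq z hz hwz hz1
  have hθ₁ : 0 ≤ θ₁ := by linarith [h₁.1]
  have hθ₂ : 0 ≤ θ₂ := by linarith [h₂.1]
  refine le_trans ?_ (det_sq_mul_le hθ₁ hθ₂ hqv hqz hiv hiz)
  have hθθ : 81 ≤ θ₁ * θ₂ := by nlinarith [h₁.1, h₂.1]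
  refine mul_le_mul ?_ hu.2.2.1 (by linarith) (by positivity)
  nlinarith

lemma card_le_of_window {ι : Type*} (S : Finset ι) (g : ι → ℝ) {w lo W : ℝ} (hw : 0 < w)
    (hW : 0 ≤ W) (hg : ∀ i ∈ S, g i ∈ Set.Icc lo (lo + W))
    (h2 : ∀ i ∈ S, ∀ j ∈ S, ∀ k ∈ S, i ≠ j → i ≠ k → j ≠ k →
      |g j - g i| ≤ w → |g k - g i| ≤ w → False) :
    (S.card : ℝ) ≤ 2 * (W / w + 2) := by
  classical
  have h3 : S.card ≤ 2 * (Finset.Icc ⌊lo / w⌋ ⌊(lo + W) / w⌋).card := by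
    refine Finset.card_le_mul_card_image_of_maps_to (f := fun i => ⌊g i / w⌋) ?_ 2 ?_
    · intro i hi
      obtain ⟨h4, h5⟩ := hg i hi
      rw [Finset.mem_Icc]
      exact ⟨Int.floor_mono (by gcongr), Int.floor_mono (by gcongr)⟩
    · intro s _
      by_contra! hcard
      obtain ⟨i, hi, j, hj, k, hk, hij, hik, hjk⟩ := Finset.two_lt_card.1 hcard
      rw [Finset.mem_filter] at hi hj hk
      have hclose : ∀ l, ⌊g l / w⌋ = s → |g l - g i| ≤ w := by
        intro l hl
        have h6 := Int.abs_sub_lt_one_of_floor_eq_floor (hl.trans hi.2.symm)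
        rw [← sub_div, abs_div, abs_of_pos hw, div_lt_one hw] at h6
        exact h6.le
      exact h2 i hi.1 j hj.1 k hk.1 hij hik hjk (hclose j hj.2) (hclose k hk.2)
  have h4 : ((Finset.Icc ⌊lo / w⌋ ⌊(lo + W) / w⌋).card : ℝ) ≤ W / w + 2 := by
    rw [Int.card_Icc]
    have h5 : (((⌊(lo + W) / w⌋ + 1 - ⌊lo / w⌋).toNat : ℤ) : ℝ) ≤ W / w + 2 := by
      rw [Int.toNat_of_nonneg]
      · push_cast
        have h6 := Int.floor_le ((lo + W) / w)
        have h7 := Int.lt_floor_add_one (lo / w)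
        have h8 := add_div lo W w
        linarith
      · have : ⌊lo / w⌋ ≤ ⌊(lo + W) / w⌋ := Int.floor_mono (by gcongr; linarith)
        linarith
    exact_mod_cast h5
  have h5 : (S.card : ℝ) ≤ 2 * (Finset.Icc ⌊lo / w⌋ ⌊(lo + W) / w⌋).card := by exact_mod_cast h3
  linarith

lemma card_sector_le {θ₁ θ₂ x : ℝ} (h₁ : θ₁ ∈ Set.Icc (9 : ℝ) 160)
    (h₂ : θ₂ ∈ Set.Icc (9 : ℝ) 160) (c : ℤ) {L : ℕ} (hL : 1 ≤ L) (S : Finset (ℤ × ℤ))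
    (hS : ∀ m ∈ S, m.1 ∈ intBall c L ∧ InSector θ₁ θ₂ x m) :
    (S.card : ℝ) ≤ 84 * (L : ℝ) ^ (2 / 3 : ℝ) := by
  have hL' : (1 : ℝ) ≤ L := by exact_mod_cast hL
  have hLp : (1 : ℝ) ≤ (L : ℝ) ^ (2 / 3 : ℝ) := Real.one_le_rpow hL' (by norm_num)
  rcases lt_or_ge x 2 with hx | hx
  -- Here the form is below 4, while nonzero points have value at least 9.
  · have h0 : ∀ m ∈ S, m = (0, 0) := by
      intro m hm
      obtain ⟨-, h3, h4, h5, h6⟩ := hS m hm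
      have hθ₁ := h₁.1
      have hθ₂ := h₂.1
      have e2 : m.2 = 0 := by
        by_contra hne
        have : (1 : ℝ) ≤ (m.2 : ℝ) ^ 2 := by
          rw [one_le_sq_iff_one_le_abs]
          exact_mod_cast Int.one_le_abs hne
        nlinarith [sq_nonneg (m.1 : ℝ)]
      have e1 : m.1 = 0 := by
        by_contra hne
        have : (1 : ℝ) ≤ (m.1 : ℝ) ^ 2 := by
          rw [one_le_sq_iff_one_le_abs]
          exact_mod_cast Int.one_le_abs hne
        rw [e2] at h4
        norm_num at h4
        nlinarith
      exact Prod.ext e1 e2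
    have h1 : S.card ≤ 1 := Finset.card_le_one.2 fun m hm n hn => (h0 m hm).trans (h0 n hn).symm
    have h1' : (S.card : ℝ) ≤ 1 := by exact_mod_cast h1
    linarith
  · set y : ℝ := x ^ (1 / 6 : ℝ) with hy
    have hx0 : 0 < x := by linarith
    have hypos : 0 < y := Real.rpow_pos_of_pos hx0 _
    have hy6 : y ^ 6 = x := by
      rw [hy, ← Real.rpow_natCast, ← Real.rpow_mul hx0.le]
      norm_num
    -- With `w = y / 20` the bound of `le_of_three` reads `81 x ≤ 32 x`.
    have hwin : ∀ i ∈ S, ∀ j ∈ S, ∀ k ∈ S, i ≠ j → i ≠ k → j ≠ k →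
        |(j.1 : ℝ) - i.1| ≤ y / 20 → |(k.1 : ℝ) - i.1| ≤ y / 20 → False := by
      intro i hi j hj k hk hij hik hjk hwj hwk
      have := (hS i hi).2.le_of_three h₁ h₂ hx (hS j hj).2 (hS k hk).2 hij hik hjk hwj hwk
      rw [show 4 * (800 * (y / 20) ^ 2) ^ 3 = 32 * y ^ 6 by ring, hy6] at this
      linarith
    have hy20 : 0 < y / 20 := by positivity
    have hb1 := card_le_of_window S (fun m => (m.1 : ℝ)) (w := y / 20) (lo := c - L) (W := 2 * L)
      hy20 (by positivity) (fun m hm => by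
        have h3 := mem_intBall.1 (hS m hm).1
        have h4 : ((c : ℝ) - L) ≤ m.1 := by exact_mod_cast h3.1
        have h5 : (m.1 : ℝ) ≤ c + L := by exact_mod_cast h3.2
        constructor <;> linarith) hwin
    have hb2 := card_le_of_window S (fun m => (m.1 : ℝ)) (w := y / 20) (lo := -(y ^ 3 / 2))
      (W := y ^ 3) hy20 (by positivity) (fun m hm => by
        obtain ⟨-, h3, h4, h5, h6⟩ := hS m hm
        have h7 : (m.1 : ℝ) ^ 2 ≤ (y ^ 3 / 2) ^ 2 := by
          have := h₁.1
          rw [show (y ^ 3 / 2) ^ 2 = y ^ 6 / 4 by ring, hy6]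
          nlinarith [sq_nonneg (m.1 : ℝ)]
        have h8 := abs_le.1 (abs_le_of_sq_le_sq h7 (by positivity))
        constructor <;> linarith [h8.1, h8.2]) hwin
    set l : ℝ := (2 * (L : ℝ)) ^ (1 / 3 : ℝ) with hl
    have hlpos : 0 < l := by positivity
    have hl3 : l ^ 3 = 2 * L := by
      rw [hl, ← Real.rpow_natCast, ← Real.rpow_mul (by positivity)]
      norm_num
    have hl2 : l ^ 2 ≤ 2 * (L : ℝ) ^ (2 / 3 : ℝ) := by
      rw [hl, ← Real.rpow_natCast, ← Real.rpow_mul (by positivity),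
        Real.mul_rpow (by norm_num) (by positivity)]
      norm_num only [Nat.cast_ofNat]
      gcongr
      calc (2 : ℝ) ^ (2 / 3 : ℝ) ≤ 2 ^ (1 : ℝ) := by gcongr <;> norm_num
        _ = 2 := Real.rpow_one 2
    -- The cube gives about `L / y` windows and the diameter of the shell about `y²`; they balance
    -- at `y = l`.
    have hfin : (S.card : ℝ) ≤ 2 * (20 * l ^ 2 + 2) := by
      rcases le_total l y with h | h
      · refine hb1.trans ?_
        gcongr
        rw [div_le_iff₀ hy20, ← hl3]
        nlinarith [sq_nonneg l]
      · refine hb2.trans ?_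
        gcongr
        rw [div_le_iff₀ hy20]
        nlinarith [mul_le_mul h h hypos.le hlpos.le]
    linarith

lemma shellBound_two : ShellBound 2 (2 / 3) := by
  classical
  refine ⟨4 * 84, by norm_num, fun θ hθ c L hL a S hS => ?_⟩
  have hS' : ∀ m ∈ S, m 0 ∈ intBall (c 0) L ∧ m 1 ∈ intBall (c 1) L ∧
      θ 0 * (m 0 : ℝ) ^ 2 + θ 1 * (m 1 : ℝ) ^ 2 ∈ Set.Icc a (a + 2) := by
    intro m hm
    have := (hS m hm).2
    rw [Fin.sum_univ_two] at this
    exact ⟨(hS m hm).1 0, (hS m hm).1 1, this⟩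
  have hext : ∀ m n : Fin 2 → ℤ, m 0 = n 0 → m 1 = n 1 → m = n := by
    intro m n h0 h1
    ext j
    fin_cases j
    exacts [h0, h1]
  -- Exchanging the axes and reflecting (`s = ±1`) carry all four sectors to `InSector`.
  have hA : ∀ (p : (Fin 2 → ℤ) → Prop) [DecidablePred p] (i j : Fin 2) (s : ℤ),
      (∀ m n : Fin 2 → ℤ, (m i, s * m j) = (n i, s * n j) → m = n) →
      (∀ m ∈ S, p m → InSector (θ i) (θ j) a (m i, s * m j)) →
      ((S.filter p).card : ℝ) ≤ 84 * (L : ℝ) ^ (2 / 3 : ℝ) := by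
    intro p _ i j s hinj hp
    rw [← Finset.card_image_of_injOn (f := fun m : Fin 2 → ℤ => (m i, s * m j))
      fun m _ n _ h => hinj m n h]
    refine card_sector_le (x := a) (hθ i) (hθ j) (c i) hL _ fun x hx => ?_
    obtain ⟨m, hm, rfl⟩ := Finset.mem_image.1 hx
    obtain ⟨hm, hpm⟩ := Finset.mem_filter.1 hm
    exact ⟨(hS m hm).1 i, hp m hm hpm⟩
  set A := S.filter fun m => θ 0 * (m 0 : ℝ) ^ 2 ≤ θ 1 * (m 1 : ℝ) ^ 2 ∧ 0 ≤ m 1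
  set B := S.filter fun m => θ 0 * (m 0 : ℝ) ^ 2 ≤ θ 1 * (m 1 : ℝ) ^ 2 ∧ m 1 ≤ 0
  set C := S.filter fun m => θ 1 * (m 1 : ℝ) ^ 2 ≤ θ 0 * (m 0 : ℝ) ^ 2 ∧ 0 ≤ m 0
  set D := S.filter fun m => θ 1 * (m 1 : ℝ) ^ 2 ≤ θ 0 * (m 0 : ℝ) ^ 2 ∧ m 0 ≤ 0
  have hcard : S.card ≤ A.card + B.card + (C.card + D.card) := by
    refine le_trans (Finset.card_le_card (t := (A ∪ B) ∪ (C ∪ D)) fun m hm => ?_)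
      ((Finset.card_union_le _ _).trans
        (Nat.add_le_add (Finset.card_union_le _ _) (Finset.card_union_le _ _)))
    simp only [A, B, C, D, Finset.mem_union, Finset.mem_filter, hm, true_and]
    rcases le_total (θ 0 * (m 0 : ℝ) ^ 2) (θ 1 * (m 1 : ℝ) ^ 2) with h | h <;>
      rcases le_total 0 (m 0) with h' | h' <;> rcases le_total 0 (m 1) with h'' | h'' <;> tauto
  have hAb : (A.card : ℝ) ≤ 84 * (L : ℝ) ^ (2 / 3 : ℝ) := by
    refine hA _ 0 1 1 (fun m n h => ?_) fun m hm h => ⟨?_, ?_, ?_⟩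
    · simp only [Prod.mk.injEq, one_mul] at h
      exact hext m n h.1 h.2
    · simpa using h.2
    · simpa using h.1
    · simpa using (hS' m hm).2.2
  have hBb : (B.card : ℝ) ≤ 84 * (L : ℝ) ^ (2 / 3 : ℝ) := by
    refine hA _ 0 1 (-1) (fun m n h => ?_) fun m hm h => ⟨?_, ?_, ?_⟩
    · simp only [Prod.mk.injEq, neg_one_mul, neg_inj] at h
      exact hext m n h.1 h.2
    · simpa using h.2
    · simpa using h.1
    · simpa using (hS' m hm).2.2
  have hCb : (C.card : ℝ) ≤ 84 * (L : ℝ) ^ (2 / 3 : ℝ) := by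
    refine hA _ 1 0 1 (fun m n h => ?_) fun m hm h => ⟨?_, ?_, ?_⟩
    · simp only [Prod.mk.injEq, one_mul] at h
      exact hext m n h.2 h.1
    · simpa using h.2
    · simpa using h.1
    · simpa [add_comm] using (hS' m hm).2.2
  have hDb : (D.card : ℝ) ≤ 84 * (L : ℝ) ^ (2 / 3 : ℝ) := by
    refine hA _ 1 0 (-1) (fun m n h => ?_) fun m hm h => ⟨?_, ?_, ?_⟩
    · simp only [Prod.mk.injEq, neg_one_mul, neg_inj] at h
      exact hext m n h.2 h.1
    · simpa using h.2
    · simpa using h.1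
    · simpa [add_comm] using (hS' m hm).2.2
  have hcard' : (S.card : ℝ) ≤ A.card + B.card + (C.card + D.card) := by exact_mod_cast hcard
  linarith

end PlanarShell

/-! ### From resonant pairs to shells, and the conclusion. -/

namespace FlatTorus

lemma shellBound_s₀ {d : ℕ} (hd : 2 ≤ d) {ε : ℝ} (hε : 0 < ε) : ShellBound d (2 * s₀ d ε) := by
  unfold s₀
  split_ifs with h2 hodd
  · subst h2
    exact shellBound_two.mono (by norm_num)
  · rcases (by omega : d = 3 ∨ 4 ≤ d) with rfl | h4
    · exact (shellBound_three (δ := 2 * ε) (by positivity)).mono (by norm_num; linarith)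
    · refine (shellBound_of_four_le h4 (δ := 2 * ε) (by positivity)).mono ?_
      have h : (d : ℝ) / (d + 1) ≤ 1 := div_le_one_of_le₀ (by linarith) (by positivity)
      linarith
  · have h4 : 4 ≤ d := by
      by_contra h
      have : d = 3 := by omega
      exact hodd (by rw [this]; decide)
    exact (shellBound_of_four_le h4 (δ := 2 * ε) (by positivity)).mono (by linarith)

lemma s₀_nonneg {d : ℕ} (hd : 2 ≤ d) {ε : ℝ} (hε : 0 < ε) : 0 ≤ s₀ d ε := by
  have hd' : (2 : ℝ) ≤ d := by exact_mod_cast hd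
  have h : (d : ℝ) / (d + 1) ≤ 1 := div_le_one_of_le₀ (by linarith) (by positivity)
  unfold s₀
  split_ifs
  · norm_num
  · linarith
  · linarith

lemma Q_eq_sum {d : ℕ} (α : Fin d → ℝ) (n : Fin d → ℤ) :
    Q α n = ∑ j, (2 * Real.pi / α j) ^ 2 * (n j : ℝ) ^ 2 :=
  Finset.sum_congr rfl fun j _ => by ring

/-- Parallelogram law: for a given sum, the total energy of a pair is read off from its difference.
-/
lemma sum_sq_two_mul_sub {d : ℕ} (α : Fin d → ℝ) (m n : Fin d → ℤ) :
    ∑ j, (2 * Real.pi / α j) ^ 2 * ((m j - n j : ℤ) : ℝ) ^ 2 =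
      2 * (Q α m + Q α n) - Q α (m + n) := by
  simp only [Q_eq_sum, ← Finset.sum_add_distrib, Finset.mul_sum, ← Finset.sum_sub_distrib]
  refine Finset.sum_congr rfl fun j _ => ?_
  rw [Pi.add_apply]
  push_cast
  ring

/-- Since `π ≤ 2 π / a ≤ 4 π`; this is the source of the range `9 ≤ θⱼ ≤ 160`. -/
lemma frequency_mem_Icc {a : ℝ} (ha : a ∈ Set.Icc (1 / 2 : ℝ) 2) :
    (2 * Real.pi / a) ^ 2 ∈ Set.Icc (9 : ℝ) 160 := by
  obtain ⟨h1, h2⟩ := ha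
  have ha0 : 0 < a := by linarith
  have hpi := Real.pi_gt_three
  have hpi' := Real.pi_lt_d2
  have h3 : 3 ≤ 2 * Real.pi / a := by
    rw [le_div_iff₀ ha0]
    linarith
  have h4 : 2 * Real.pi / a ≤ 12.6 := by
    rw [div_le_iff₀ ha0]
    linarith
  constructor <;> nlinarith

/-- The number of pairs of frequencies with sum `p` and total energy in a unit interval, one of
them in a cube of side `2 N`. -/
lemma exists_card_resonant_le {d : ℕ} {e : ℝ} (he : 0 ≤ e) (h : ShellBound d e) :
    ∃ C : ℝ, 0 < C ∧ ∀ α : Fin d → ℝ, (∀ j, α j ∈ Set.Icc (1 / 2 : ℝ) 2) → ∀ N : ℝ, 1 ≤ N →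
      ∀ (p : Fin d → ℤ) (a : ℝ) (S : Finset ((Fin d → ℤ) × (Fin d → ℤ))),
        (∀ x ∈ S, x.1 ∈ box d N ∧ x.1 + x.2 = p ∧ Q α x.1 + Q α x.2 ∈ Set.Icc a (a + 1)) →
        (S.card : ℝ) ≤ C * N ^ e := by
  classical
  obtain ⟨C, hC, h⟩ := h
  refine ⟨C * 4 ^ e, by positivity, fun α hα N hN p a S hS => ?_⟩
  have hceil : N ≤ ⌈N⌉₊ := Nat.le_ceil N
  have hceil' : (⌈N⌉₊ : ℝ) ≤ 2 * N := by linarith [Nat.ceil_lt_add_one (by linarith : 0 ≤ N)]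
  have hinj : Set.InjOn (fun x : (Fin d → ℤ) × (Fin d → ℤ) => x.1 - x.2) S := by
    intro x hx y hy hxy
    have h1 : x.1 + x.2 = y.1 + y.2 := (hS x hx).2.1.trans (hS y hy).2.1.symm
    have h2 : x.1 - x.2 = y.1 - y.2 := hxy
    refine Prod.ext (funext fun j => ?_) (funext fun j => ?_)
    all_goals
      have h3 := congrFun h1 j
      have h4 := congrFun h2 j
      simp only [Pi.add_apply, Pi.sub_apply] at h3 h4
      omega
  -- `x.1 - x.2 = 2 x.1 - p` is within `2 ⌈N⌉₊ ≤ 4 N` of `-p`; doubling the energy turns the unit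
  -- interval into one of length 2.
  have hle := h (fun j => (2 * Real.pi / α j) ^ 2) (fun j => frequency_mem_Icc (hα j))
    (-p) (2 * ⌈N⌉₊) (by have := Nat.ceil_pos.2 (by linarith : 0 < N); omega)
    (2 * a - Q α p) (S.image fun x => x.1 - x.2) (by
      intro m hm
      obtain ⟨x, hx, rfl⟩ := Finset.mem_image.1 hm
      obtain ⟨hbox, rfl, hQ⟩ := hS x hx
      refine ⟨fun j => ?_, ?_⟩
      · obtain ⟨h1, h2⟩ := hbox j
        have h3 : -(⌈N⌉₊ : ℤ) ≤ x.1 j := by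
          have : -(⌈N⌉₊ : ℝ) ≤ x.1 j := by linarith
          exact_mod_cast this
        have h4 : x.1 j ≤ (⌈N⌉₊ : ℤ) := by
          have : (x.1 j : ℝ) ≤ ⌈N⌉₊ := by linarith
          exact_mod_cast this
        rw [mem_intBall]
        simp only [Pi.neg_apply, Pi.add_apply, Pi.sub_apply]
        push_cast
        constructor <;> linarith
      · simp only [Pi.sub_apply]
        rw [sum_sq_two_mul_sub]
        constructor <;> linarith [hQ.1, hQ.2])
  rw [Finset.card_image_of_injOn hinj] at hle
  refine hle.trans ?_
  rw [mul_assoc, ← Real.mul_rpow (by norm_num) (by linarith)]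
  refine mul_le_mul_of_nonneg_left (Real.rpow_le_rpow (by positivity) ?_ he) hC.le
  push_cast
  linarith

lemma half_pow_le_prod {d : ℕ} {α : Fin d → ℝ} (hα : ∀ j, α j ∈ Set.Icc (1 / 2 : ℝ) 2) :
    (1 / 2 : ℝ) ^ d ≤ ∏ j, α j := by
  have := Finset.prod_le_prod (s := Finset.univ) (f := fun _ : Fin d => (1 / 2 : ℝ)) (g := α)
    (fun _ _ => by norm_num) fun j _ => (hα j).1
  simpa using this

end FlatTorus

theorem proposition2 (d : ℕ) (hd : 2 ≤ d) (ε : ℝ) (hε : 0 < ε) (T : ℝ) (hT : 0 < T) :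
    ∃ C : ℝ, 0 < C ∧
      ∀ (α : Fin d → ℝ) [∀ j, Fact (0 < α j)], (∀ j, α j ∈ Set.Icc (1 / 2 : ℝ) 2) →
      ∀ N₁ N₂ : ℝ, 1 ≤ N₁ → 1 ≤ N₂ →
      ∀ f₁ f₂ : FlatTorus.L2 α,
        FlatTorus.spectrum f₁ ⊆ FlatTorus.box d N₁ →
        FlatTorus.spectrum f₂ ⊆ FlatTorus.box d N₂ →
        FlatTorus.normL2L2 T
            (fun t x => FlatTorus.schrodinger t f₁ x * FlatTorus.schrodinger t f₂ x) ≤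
          ENNReal.ofReal (C * (min N₁ N₂) ^ (FlatTorus.s₀ d ε) * ‖f₁‖ * ‖f₂‖) := by
  classical
  have hs := FlatTorus.s₀_nonneg hd hε
  obtain ⟨C, hC, hcount⟩ := FlatTorus.exists_card_resonant_le (by positivity)
    (FlatTorus.shellBound_s₀ hd hε)
  have hK := sieveConst_nonneg T
  -- `2 ^ d` bounds the inverse volume of the torus; the `+ 1` only ensures positivity.
  refine ⟨√(sieveConst T * C * 2 ^ d) + 1, by positivity, ?_⟩
  intro α _ hα N₁ N₂ hN₁ hN₂ f₁ f₂ h₁ h₂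
  set N := min N₁ N₂ with hN
  have hN1 : 1 ≤ N := le_min hN₁ hN₂
  have hNpos : 0 < N := by linarith
  refine (FlatTorus.normL2L2_le_of_card (M := C * N ^ (2 * FlatTorus.s₀ d ε))
    (FlatTorus.finite_box N₁) (FlatTorus.finite_box N₂) (fun p a S hS => ?_) f₁ f₂ h₁ h₂).trans ?_
  · rcases min_choice N₁ N₂ with h | h
    · refine hcount α hα N hN1 p a S fun x hx => ?_
      obtain ⟨hx₁, -, hx⟩ := hS x hx
      rw [hN, h]
      exact ⟨hx₁, hx⟩
    -- When `N₂` is the minimum, the two frequencies exchange roles.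
    · rw [← Finset.card_image_of_injective S Prod.swap_injective]
      refine hcount α hα N hN1 p a _ fun y hy => ?_
      obtain ⟨x, hx, rfl⟩ := Finset.mem_image.1 hy
      obtain ⟨-, hx₂, hxp, hxQ⟩ := hS x hx
      rw [hN, h]
      refine ⟨hx₂, (add_comm _ _).trans hxp, ?_⟩
      exact (add_comm (FlatTorus.Q α x.2) _).symm ▸ hxQ
  · refine ENNReal.ofReal_le_ofReal ?_
    gcongr
    have hV := FlatTorus.half_pow_le_prod hα
    have hVinv : (∏ j, α j)⁻¹ ≤ 2 ^ d := by
      have := inv_anti₀ (by positivity) hV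
      rwa [one_div, inv_pow, inv_inv] at this
    have hpow : N ^ (2 * FlatTorus.s₀ d ε) = (N ^ FlatTorus.s₀ d ε) ^ 2 := by
      rw [mul_comm, Real.rpow_mul hNpos.le, Real.rpow_ofNat]
    calc √(sieveConst T * (C * N ^ (2 * FlatTorus.s₀ d ε)) / ∏ j, α j)
        ≤ √(sieveConst T * C * 2 ^ d * (N ^ FlatTorus.s₀ d ε) ^ 2) := by
          refine Real.sqrt_le_sqrt ?_
          rw [hpow, div_eq_mul_inv, show sieveConst T * C * 2 ^ d * (N ^ FlatTorus.s₀ d ε) ^ 2 =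
            sieveConst T * (C * (N ^ FlatTorus.s₀ d ε) ^ 2) * 2 ^ d by ring]
          gcongr
      _ = √(sieveConst T * C * 2 ^ d) * N ^ FlatTorus.s₀ d ε := by
          rw [Real.sqrt_mul (by positivity), Real.sqrt_sq (by positivity)]
      _ ≤ _ := by
          gcongr
          linarith
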